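/- Let $G$ be a finite group, and let $\mathcal N=(\mathcal N(H))_{H\le G}$ be a set of exponents, i.e. for each subgroup $H\le G$ a set $\mathcal N(H)$ of finite $H$-sets $T$, each with a chosen ordering $\{1,\dots,|T|\}\cong T$ (the action need not preserve the order). For such a $T$, let $\sigma:H\to\Sigma_{|T|}$ be the permutation representation of the $H$-action and put $\Gamma_T=\{(h,\sigma(h)) : h\in H\}\le G\times\Sigma_{|T|}$. Let $$S_{\mathcal N}=(G\times\Sigma_0)/\Gamma_\varnothing\ \sqcup\ (G\times\Sigma_2)/\Gamma_{**}\ \sqcup\coprod_{T\in\mathcal N}(G\times\Sigma_{|T|})/\Gamma_T$$ be the graded coproduct in the category of symmetric sequences of $G$-sets, where $\varnothing$ and the two-point set $**$ are $G$-sets with trivial action. Let $\mathbb F(S_{\mathcal N})$ be the free operad in $G$-sets on $S_{\mathcal N}$, and let $\mathcal{SM}_{\mathcal N}$ be the operad in $G$-categories obtained by replacing each set $\mathbb F(S_{\mathcal N})(n)$ by the category with this set of objects and exactly one morphism between any two objects. Then: 1. $\mathcal{SM}_{\mathcal N}$ is a categorical $N_\infty$ operad. That is, the classifying spaces $X_n=B\mathcal{SM}_{\mathcal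 N}(n)$ with their $G\times\Sigma_n$-actions satisfy: $X_0$ is $G$-contractible; $\Sigma_n$ acts freely on $X_n$ for all $n\ge0$; and for all $n\ge 0$, $X_n$ is a universal space for a family $\mathcal F_n$ of subgroups of $G\times\Sigma_n$ (closed under subgroups and conjugation) that contains $H\times 1$ for all $H\le G$, i.e. $X_n^\Lambda$ is contractible for $\Lambda\in\mathcal F_n$ and empty for $\Lambda\notin\mathcal F_n$. 2. The class of admissible sets of $\mathcal{SM}_{\mathcal N}$ is the indexing system generated by $\mathcal N$. Here a finite $H$-set $T$ ($H\le G$) is admissible if $\Gamma_T\in\mathcal F_{|T|}$ (for some, equivalently any, ordering of $T$). An indexing system is a class of finite $H$-sets, for every $H\le G$, that contains all trivial actions and is closed under isomorphism, restriction to subgroups, conjugation by elements of $G$, subobjects, finite coproducts, finite products, and self-induction (if $K\le H$, the orbit $H/K$ is in the class and $T$ is a $K$-set in the class, then $H\times_K T$ is in the class). The indexing system generated by $\mathcal N$ is the smallest one that contains every $T\in\mathcal N$. -/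

import Mathlib

open CategoryTheory

universe u v w

/-! ## Finite actions of subgroups, sets of exponents and indexing systems -/

/-- A finite `H`-set. -/
structure FinAct (H : Type u) [Group H] : Type (u + 1) where
  carrier : Type u
  [action : MulAction H carrier]
  [finite : Finite carrier]

attribute [instance] FinAct.action FinAct.finite

/-- An ordered finite `H`-set: a finite `H`-set `T` with a chosen bijection `{1, …, |T|} ≃ T`.
The action need not preserve the order. -/
structure OrdFinAct (H : Type u) [Group H] : Type (u + 1) extends FinAct H where
  card : ℕ
  ordering : Fin card ≃ carrier

/-- A graded class of finite subgroup actions: a class of finite `H`-sets for every `H ≤ G`. -/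
abbrev GradedClass (G : Type u) [Group G] : Type (u + 1) :=
  ∀ H : Subgroup G, Set (FinAct H)

/-- A set of exponents: a set of ordered finite `H`-sets for every subgroup `H ≤ G`. -/
abbrev Exponents (G : Type u) [Group G] : Type (u + 1) :=
  ∀ H : Subgroup G, Set (OrdFinAct H)

/-- The graded class of the finite actions in a set of exponents (forgetting the orderings). -/
def Exponents.underlying {G : Type u} [Group G] (N : Exponents G) : GradedClass G :=
  fun H => OrdFinAct.toFinAct '' N H

namespace FinAct

/-- `f` is a map of `H`-sets. -/
def IsEquivariant {H : Type u} [Group H] {S T : FinAct H} (f : S.carrier → T.carrier) : Prop :=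
  ∀ (h : H) (s : S.carrier), f (h • s) = h • f s

/-- Pull an action back along a homomorphism. -/
def comap {H K : Type u} [Group H] [Group K] (φ : K →* H) (T : FinAct H) : FinAct K where
  carrier := T.carrier
  action := MulAction.compHom T.carrier φ

/-- The conjugate of the `H`-set `T` by `g`: the `gHg⁻¹`-set `T` with `(g h g⁻¹) • t = h • t`. -/
def conj {G : Type u} [Group G] {H : Subgroup G} (g : G) (T : FinAct H) :
    FinAct (H.map (MulAut.conj g).toMonoidHom) :=
  T.comap ((MulAut.conj g).subgroupMap H).symm.toMonoidHom

/-- The disjoint union of two `H`-sets. -/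
def sum {H : Type u} [Group H] (S T : FinAct H) : FinAct H where
  carrier := S.carrier ⊕ T.carrier

/-- The product of two `H`-sets, with the diagonal action. -/
def prod {H : Type u} [Group H] (S T : FinAct H) : FinAct H where
  carrier := S.carrier × T.carrier

/-- The orbit `H/K`, for `K ≤ H ≤ G`. -/
def orbit {G : Type u} [Group G] [Finite G] (K H : Subgroup G) : FinAct H where
  carrier := H ⧸ K.subgroupOf H

/-- The relation `(h, t) ∼ (h k⁻¹, k t)` on `H × T`, for `k ∈ K`. -/
def inducedSetoid {G : Type u} [Group G] {K H : Subgroup G} (hKH : K ≤ H) (T : FinAct K) :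
    Setoid (H × T.carrier) where
  r x y := ∃ k : K, y = (x.1 * (Subgroup.inclusion hKH k)⁻¹, k • x.2)
  iseqv :=
    { refl := fun x => ⟨1, by simp⟩
      symm := by
        rintro ⟨h, t⟩ _ ⟨k, rfl⟩
        exact ⟨k⁻¹, by simp⟩
      trans := by
        rintro ⟨h, t⟩ _ _ ⟨k, rfl⟩ ⟨l, rfl⟩
        exact ⟨l * k, by simp [mul_smul, mul_assoc]⟩ }

/-- The induced `H`-set `H ×_K T` of a `K`-set `T`, for `K ≤ H`. -/
def induced {G : Type u} [Group G] [Finite G] {K H : Subgroup G} (hKH : K ≤ H) (T : FinAct K) :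
    FinAct H where
  carrier := Quotient (inducedSetoid hKH T)
  action :=
    { smul := fun a => Quotient.map (fun x => (a * x.1, x.2)) (by
        rintro ⟨h, t⟩ _ ⟨k, rfl⟩
        exact ⟨k, by simp [mul_assoc]⟩)
      one_smul := by
        rintro ⟨h, t⟩
        exact congrArg (Quotient.mk _) (by simp)
      mul_smul := by
        rintro a b ⟨h, t⟩
        exact congrArg (Quotient.mk _) (by simp [mul_assoc]) }

/-- The permutation representation `σ : H → Σₙ` of an `H`-set ordered by `e : {1, …, n} ≃ T`. -/
def permRep {H : Type u} [Group H] (T : FinAct H) {n : ℕ} (e : Fin n ≃ T.carrier) :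
    H →* Equiv.Perm (Fin n) :=
  e.symm.permCongrHom.toMonoidHom.comp (MulAction.toPermHom H T.carrier)

end FinAct

/-- The graph `{(h, σ h) | h ∈ H} ≤ G × Σₙ` of a homomorphism `σ : H → Σₙ`. -/
def graphSubgroup {G : Type u} [Group G] (H : Subgroup G) {n : ℕ}
    (σ : H →* Equiv.Perm (Fin n)) : Subgroup (G × Equiv.Perm (Fin n)) :=
  (H.subtype.prod σ).range

/-- Indexing systems: graded classes of finite actions of subgroups of `G` that contain all trivial
actions and are closed under isomorphism, restriction, conjugation, subobjects, finite coproducts,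
finite products and self-induction. -/
structure IsIndexingSystem {G : Type u} [Group G] [Finite G] (F : GradedClass G) : Prop where
  trivial_mem : ∀ (H : Subgroup G) (T : FinAct H),
    (∀ (h : H) (t : T.carrier), h • t = t) → T ∈ F H
  iso_mem : ∀ (H : Subgroup G) (S T : FinAct H) (e : S.carrier ≃ T.carrier),
    FinAct.IsEquivariant e → S ∈ F H → T ∈ F H
  restrict_mem : ∀ (K H : Subgroup G) (hKH : K ≤ H) (T : FinAct H),
    T ∈ F H → T.comap (Subgroup.inclusion hKH) ∈ F K
  conj_mem : ∀ (H : Subgroup G) (g : G) (T : FinAct H),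
    T ∈ F H → T.conj g ∈ F (H.map (MulAut.conj g).toMonoidHom)
  subobject_mem : ∀ (H : Subgroup G) (S T : FinAct H) (i : S.carrier → T.carrier),
    Function.Injective i → FinAct.IsEquivariant i → T ∈ F H → S ∈ F H
  sum_mem : ∀ (H : Subgroup G) (S T : FinAct H), S ∈ F H → T ∈ F H → S.sum T ∈ F H
  prod_mem : ∀ (H : Subgroup G) (S T : FinAct H), S ∈ F H → T ∈ F H → S.prod T ∈ F H
  induced_mem : ∀ (K H : Subgroup G) (hKH : K ≤ H) (T : FinAct K),
    FinAct.orbit K H ∈ F H → T ∈ F K → FinAct.induced hKH T ∈ F H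

/-! ## Bijections that describe the inputs of operadic composites

The inputs of `γ(x; y₁, …, yₖ)` are numbered by the lexicographic bijection
`finSigmaFinEquiv : (Σ i, Fin (j i)) ≃ Fin (∑ i, j i)`. -/

namespace OperadIndex

/-- Permuting blocks: the `l`th input of the `i`th block goes to the `l`th input of block `τ i`. -/
def blockPerm {k : ℕ} (j : Fin k → ℕ) (τ : Equiv.Perm (Fin k)) :
    Fin (∑ i, j (τ i)) ≃ Fin (∑ i, j i) :=
  finSigmaFinEquiv.symm.trans
    ((Equiv.sigmaCongrLeft (β := fun i => Fin (j i)) τ).trans finSigmaFinEquiv)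

/-- The block sum `σ₁ ⊕ ⋯ ⊕ σₖ`. -/
def blockSum {k : ℕ} (j : Fin k → ℕ) (σ : ∀ i, Equiv.Perm (Fin (j i))) :
    Equiv.Perm (Fin (∑ i, j i)) :=
  finSigmaFinEquiv.symm.trans ((Equiv.sigmaCongrRight σ).trans finSigmaFinEquiv)

/-- The (order-preserving) identification of the inputs of `γ(id; x)` with the inputs of `x`. -/
def leftUnit (n : ℕ) : Fin (∑ _i : Fin 1, n) ≃ Fin n :=
  finSigmaFinEquiv.symm.trans (Equiv.uniqueSigma (fun _ : Fin 1 => Fin n))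

/-- The (order-preserving) identification of the inputs of `γ(x; id, …, id)` with those of `x`. -/
def rightUnit (n : ℕ) : Fin (∑ _i : Fin n, 1) ≃ Fin n :=
  finSigmaFinEquiv.symm.trans (Equiv.sigmaUnique (Fin n) (fun _ => Fin 1))

/-- The (order-preserving) identification of the inputs of `γ(γ(x; y); z)` with the inputs of
`γ(x; γ(y₁; z₁), …, γ(yₖ; zₖ))`. -/
def assoc {k : ℕ} (j : Fin k → ℕ) (l : ∀ i, Fin (j i) → ℕ) :
    Fin (∑ q : Fin (∑ i, j i), l (finSigmaFinEquiv.symm q).1 (finSigmaFinEquiv.symm q).2) ≃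
      Fin (∑ i, ∑ p, l i p) :=
  finSigmaFinEquiv.symm.trans <|
    (Equiv.sigmaCongrLeft (β := fun a : (Σ i, Fin (j i)) => Fin (l a.1 a.2))
      finSigmaFinEquiv.symm).trans <|
    (Equiv.sigmaAssoc (fun i (p : Fin (j i)) => Fin (l i p))).trans <|
    (Equiv.sigmaCongrRight fun _ => finSigmaFinEquiv).trans finSigmaFinEquiv

end OperadIndex

/-! ## Symmetric sequences and operads in `G`-sets -/

/-- A symmetric sequence in `G`-sets. The two actions are combined into a left `G × Σₙ`-action. -/
structure SymSeq (G : Type u) [Group G] where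
  obj : ℕ → Type w
  [action : ∀ n, MulAction (G × Equiv.Perm (Fin n)) (obj n)]

attribute [instance] SymSeq.action

/-- Relabel the inputs along a bijection. For `m = n` this is the action of `Σₙ`, and for `m ≠ n`
there is no such bijection. -/
def SymSeq.relabel {G : Type u} [Group G] (S : SymSeq.{u, w} G) {m n : ℕ} (e : Fin m ≃ Fin n) :
    S.obj m → S.obj n := by
  obtain rfl : m = n := Fin.equiv_iff_eq.1 ⟨e⟩
  exact fun x => ((1 : G), (e : Equiv.Perm (Fin m))) • x

/-- An operad in `G`-sets. The convention for the left action of `Σₙ` is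
`(σ • x)(c₁, …, cₙ) = x(c_{σ 1}, …, c_{σ n})`. -/
structure GSetOperad (G : Type u) [Group G] extends SymSeq.{u, w} G where
  one : obj 1
  comp : ∀ {k : ℕ} (j : Fin k → ℕ), obj k → (∀ i, obj (j i)) → obj (∑ i, j i)
  smul_one : ∀ g : G, (g, (1 : Equiv.Perm (Fin 1))) • one = one
  smul_comp : ∀ {k : ℕ} (j : Fin k → ℕ) (g : G) (x : obj k) (y : ∀ i, obj (j i)),
    (g, (1 : Equiv.Perm (Fin (∑ i, j i)))) • comp j x y =
      comp j ((g, (1 : Equiv.Perm (Fin k))) • x)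
        (fun i => (g, (1 : Equiv.Perm (Fin (j i)))) • y i)
  perm_comp : ∀ {k : ℕ} (j : Fin k → ℕ) (τ : Equiv.Perm (Fin k)) (x : obj k)
    (y : ∀ i, obj (j i)),
    comp j (((1 : G), τ) • x) y =
      toSymSeq.relabel (OperadIndex.blockPerm j τ) (comp (fun i => j (τ i)) x (fun i => y (τ i)))
  comp_perm : ∀ {k : ℕ} (j : Fin k → ℕ) (σ : ∀ i, Equiv.Perm (Fin (j i))) (x : obj k)
    (y : ∀ i, obj (j i)),
    comp j x (fun i => ((1 : G), σ i) • y i) = ((1 : G), OperadIndex.blockSum j σ) • comp j x y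
  one_comp : ∀ {n : ℕ} (x : obj n),
    toSymSeq.relabel (OperadIndex.leftUnit n) (comp (fun _ : Fin 1 => n) one (fun _ => x)) = x
  comp_one : ∀ {n : ℕ} (x : obj n),
    toSymSeq.relabel (OperadIndex.rightUnit n) (comp (fun _ : Fin n => 1) x (fun _ => one)) = x
  comp_assoc : ∀ {k : ℕ} (j : Fin k → ℕ) (l : ∀ i, Fin (j i) → ℕ) (x : obj k)
    (y : ∀ i, obj (j i)) (z : ∀ i (p : Fin (j i)), obj (l i p)),
    toSymSeq.relabel (OperadIndex.assoc j l)
        (comp (fun q => l (finSigmaFinEquiv.symm q).1 (finSigmaFinEquiv.symm q).2) (comp j x y)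
          (fun q => z (finSigmaFinEquiv.symm q).1 (finSigmaFinEquiv.symm q).2)) =
      comp (fun i => ∑ p, l i p) x (fun i => comp (l i) (y i) (z i))

/-! ## The free operad on a symmetric sequence -/

/-- Trees whose internal vertices with `n` inputs are labelled by elements of `S.obj n` and whose
free leaves are labelled by elements of `A`. -/
inductive OpTree {G : Type u} [Group G] (S : SymSeq.{u, w} G) (A : Type) : Type w
  | leaf (a : A) : OpTree S A
  | node (n : ℕ) (s : S.obj n) (t : Fin n → OpTree S A) : OpTree S A

namespace OpTree

variable {G : Type u} [Group G] {S : SymSeq.{u, w} G} {A B C : Type}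

/-- Isomorphism of labelled trees: the branches above a vertex may be permuted, provided that its
label is changed accordingly, `(σ • s)(t₁, …, tₙ) = s(t_{σ 1}, …, t_{σ n})`. -/
inductive Iso : OpTree S A → OpTree S A → Prop
  | leaf (a : A) : Iso (leaf a) (leaf a)
  | node (n : ℕ) (σ : Equiv.Perm (Fin n)) (s : S.obj n) (t t' : Fin n → OpTree S A)
      (h : ∀ i, Iso (t (σ i)) (t' i)) : Iso (node n (((1 : G), σ) • s) t) (node n s t')

/-- The free leaf labels of a tree, with multiplicity. -/
def leaves : OpTree S A → Multiset A
  | leaf a => {a}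
  | node _ _ t => ∑ i, (t i).leaves

/-- Relabel the free leaves. -/
def map (f : A → B) : OpTree S A → OpTree S B
  | leaf a => leaf (f a)
  | node n s t => node n s (fun i => (t i).map f)

/-- Let an element of `G` act on all vertex labels. -/
def gact (g : G) : OpTree S A → OpTree S A
  | leaf a => leaf a
  | node n s t => node n ((g, (1 : Equiv.Perm (Fin n))) • s) (fun i => (t i).gact g)

/-- Graft a tree onto each free leaf. -/
def bind (f : A → OpTree S B) : OpTree S A → OpTree S B
  | leaf a => f a
  | node n s t => node n s (fun i => (t i).bind f)

namespace Iso

theorem refl : ∀ t : OpTree S A, Iso t t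
  | .leaf a => .leaf a
  | .node n s t => by
    have h := Iso.node n 1 s t t (fun i => refl (t i))
    have e : ((1 : G), (1 : Equiv.Perm (Fin n))) • s = s := one_smul (G × Equiv.Perm (Fin n)) s
    rwa [e] at h

theorem symm {t t' : OpTree S A} (h : Iso t t') : Iso t' t := by
  induction h with
  | leaf a => exact .leaf a
  | node n σ s t t' _ ih =>
    have h := Iso.node n σ⁻¹ (((1 : G), σ) • s) t' t (fun i => by
      have := ih (σ⁻¹ i)
      simpa using this)
    have e : ((1 : G), σ⁻¹) • ((1 : G), σ) • s = s := by
      rw [← mul_smul, Prod.mk_mul_mk, inv_mul_cancel, mul_one]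
      exact one_smul (G × Equiv.Perm (Fin n)) s
    rwa [e] at h

theorem trans {t t' t'' : OpTree S A} (h : Iso t t') (h' : Iso t' t'') : Iso t t'' := by
  induction h generalizing t'' with
  | leaf a => exact h'
  | node n σ s t t' _ ih =>
    generalize hx : OpTree.node n s t' = x at h'
    cases h' with
    | leaf a => cases hx
    | node m τ r p p' h2 =>
      cases hx
      rw [← mul_smul]
      have := Iso.node n (σ * τ) r t p' (fun i => ih (τ i) (h2 i))
      simpa using this

theorem map (f : A → B) {t t' : OpTree S A} (h : Iso t t') : Iso (t.map f) (t'.map f) := by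
  induction h with
  | leaf a => exact .leaf _
  | node n σ s t t' _ ih => exact .node n σ s _ _ ih

theorem gact (g : G) {t t' : OpTree S A} (h : Iso t t') : Iso (t.gact g) (t'.gact g) := by
  induction h with
  | leaf a => exact .leaf _
  | node n σ s t t' _ ih =>
    have := Iso.node n σ ((g, (1 : Equiv.Perm (Fin n))) • s)
      (fun i => (t i).gact g) (fun i => (t' i).gact g) ih
    simpa [OpTree.gact, ← mul_smul] using this

theorem bind_right {f f' : A → OpTree S B} (h : ∀ a, Iso (f a) (f' a)) :
    ∀ t : OpTree S A, Iso (t.bind f) (t.bind f')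
  | .leaf a => h a
  | .node n s t => by
    have h := Iso.node n 1 s (fun i => (t i).bind f) (fun i => (t i).bind f')
      (fun i => bind_right h (t i))
    have e : ((1 : G), (1 : Equiv.Perm (Fin n))) • s = s := one_smul (G × Equiv.Perm (Fin n)) s
    rwa [e] at h

theorem bind {f f' : A → OpTree S B} (hf : ∀ a, Iso (f a) (f' a)) {t t' : OpTree S A}
    (h : Iso t t') : Iso (t.bind f) (t'.bind f') := by
  induction h with
  | leaf a => exact hf a
  | node n σ s t t' _ ih => exact .node n σ s _ _ ih

end Iso

theorem map_map (f : A → B) (g : B → C) : ∀ t : OpTree S A, (t.map f).map g = t.map (g ∘ f)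
  | leaf _ => rfl
  | node n s t => by simp only [map, map_map f g]

theorem map_id : ∀ t : OpTree S A, t.map id = t
  | leaf _ => rfl
  | node n s t => by simp only [map, map_id]

theorem gact_map (g : G) (f : A → B) : ∀ t : OpTree S A, (t.map f).gact g = (t.gact g).map f
  | leaf _ => rfl
  | node n s t => by simp only [map, gact, gact_map g f]

theorem gact_one : ∀ t : OpTree S A, t.gact 1 = t
  | leaf _ => rfl
  | node n s t => by
    have e : ((1 : G), (1 : Equiv.Perm (Fin n))) • s = s := one_smul (G × Equiv.Perm (Fin n)) s
    simp only [gact, gact_one, e]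

theorem gact_mul (g h : G) : ∀ t : OpTree S A, t.gact (g * h) = (t.gact h).gact g
  | leaf _ => rfl
  | node n s t => by
    simp only [gact, gact_mul g h, ← mul_smul, Prod.mk_mul_mk, mul_one]

theorem gact_bind (g : G) (f : A → OpTree S B) :
    ∀ t : OpTree S A, (t.bind f).gact g = (t.gact g).bind (fun a => (f a).gact g)
  | leaf _ => rfl
  | node n s t => by simp only [bind, gact, gact_bind g f]

theorem map_bind (f : A → OpTree S B) (g : B → C) :
    ∀ t : OpTree S A, (t.bind f).map g = t.bind (fun a => (f a).map g)
  | leaf _ => rfl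
  | node n s t => by simp only [bind, map, map_bind f g]

theorem bind_map (f : A → B) (g : B → OpTree S C) :
    ∀ t : OpTree S A, (t.map f).bind g = t.bind (fun a => g (f a))
  | leaf _ => rfl
  | node n s t => by simp only [bind, map, bind_map f g]

theorem bind_bind {D : Type} (f : A → OpTree S B) (g : B → OpTree S D) :
    ∀ t : OpTree S A, (t.bind f).bind g = t.bind (fun a => (f a).bind g)
  | leaf _ => rfl
  | node n s t => by simp only [bind, bind_bind f g]

theorem bind_leaf (f : A → B) : ∀ t : OpTree S A, t.bind (fun a => leaf (f a)) = t.map f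
  | leaf _ => rfl
  | node n s t => by simp only [bind, map, bind_leaf f]

theorem leaves_map (f : A → B) : ∀ t : OpTree S A, (t.map f).leaves = t.leaves.map f
  | leaf _ => by simp [map, leaves]
  | node n s t => by
    simp only [map, leaves, leaves_map f]
    exact (map_sum (Multiset.mapAddMonoidHom f) _ _).symm

theorem leaves_gact (g : G) : ∀ t : OpTree S A, (t.gact g).leaves = t.leaves
  | leaf _ => rfl
  | node n s t => by simp only [gact, leaves, leaves_gact g]

theorem leaves_bind (f : A → OpTree S B) :
    ∀ t : OpTree S A, (t.bind f).leaves = t.leaves.bind (fun a => (f a).leaves)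
  | leaf _ => by simp [bind, leaves]
  | node n s t => by
    simp only [bind, leaves, leaves_bind f]
    exact (map_sum (⟨⟨fun s => s.bind (fun a => (f a).leaves), Multiset.zero_bind _⟩,
      fun s t => Multiset.add_bind s t _⟩ : Multiset A →+ Multiset B) _ _).symm

end OpTree

/-- `n`-ary trees: the free leaves are labelled by `1, …, n`, each label being used exactly once. -/
def NTree {G : Type u} [Group G] (S : SymSeq.{u, w} G) (n : ℕ) : Type w :=
  {t : OpTree S (Fin n) // t.leaves = Finset.univ.val}

namespace NTree

variable {G : Type u} [Group G] {S : SymSeq.{u, w} G}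

instance setoid (S : SymSeq.{u, w} G) (n : ℕ) : Setoid (NTree S n) where
  r t t' := OpTree.Iso t.1 t'.1
  iseqv := ⟨fun t => .refl t.1, fun h => h.symm, fun h h' => h.trans h'⟩

/-- The trivial tree, consisting of one free leaf. -/
def one : NTree S 1 := ⟨.leaf 0, rfl⟩

/-- The corolla on `s`. -/
def corolla {n : ℕ} (s : S.obj n) : NTree S n :=
  ⟨.node n s .leaf, by
    simp only [OpTree.leaves]
    exact Finset.sum_multiset_singleton _⟩

/-- Relabel the free leaves along a bijection. -/
def map {m n : ℕ} (e : Fin m ≃ Fin n) (t : NTree S m) : NTree S n :=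
  ⟨t.1.map e, by
    rw [OpTree.leaves_map, t.2]
    exact congrArg Finset.val (Finset.map_univ_equiv e)⟩

/-- Let an element of `G` act on all vertex labels. -/
def gact {n : ℕ} (g : G) (t : NTree S n) : NTree S n :=
  ⟨t.1.gact g, by rw [OpTree.leaves_gact, t.2]⟩

/-- Graft `u i` onto the free leaf `i` of `t`, and number the free leaves lexicographically. -/
def graft {k : ℕ} {j : Fin k → ℕ} (t : NTree S k) (u : ∀ i, NTree S (j i)) :
    NTree S (∑ i, j i) :=
  ⟨t.1.bind (fun i => (u i).1.map (fun l => finSigmaFinEquiv ⟨i, l⟩)), by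
    simp only [OpTree.leaves_bind, OpTree.leaves_map, t.2, (u _).2]
    have h := congrArg Finset.val
      (Finset.map_univ_equiv (finSigmaFinEquiv : (Σ i, Fin (j i)) ≃ Fin (∑ i, j i)))
    rw [← h, ← Finset.univ_sigma_univ]
    have h' : (Finset.univ.sigma fun i : Fin k => (Finset.univ : Finset (Fin (j i)))).val =
        Finset.univ.val.bind fun i => Finset.univ.val.map (Sigma.mk i) := rfl
    rw [Finset.map_val, h', Multiset.map_bind]
    simp only [Multiset.map_map]
    rfl⟩

end NTree

/-- The `n`th component of the free operad on `S`: isomorphism classes of `n`-ary trees. -/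
def FreeOp {G : Type u} [Group G] (S : SymSeq.{u, w} G) (n : ℕ) : Type w :=
  Quotient (NTree.setoid S n)

namespace FreeOp

variable {G : Type u} [Group G] {S : SymSeq.{u, w} G}

/-- The isomorphism class of a tree. -/
def mk {n : ℕ} (t : NTree S n) : FreeOp S n := Quotient.mk _ t

theorem sound {n : ℕ} {t t' : NTree S n} (h : OpTree.Iso t.1 t'.1) : mk t = mk t' :=
  Quotient.sound h

theorem sound_eq {n : ℕ} {t t' : NTree S n} (h : t.1 = t'.1) : mk t = mk t' :=
  congrArg mk (Subtype.ext h)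

theorem exists_rep {n : ℕ} (x : FreeOp S n) : ∃ t, mk t = x := Quotient.exists_rep x

/-- `G` acts on the vertex labels and `Σₙ` acts on the labels of the free leaves. -/
instance action (S : SymSeq.{u, w} G) (n : ℕ) :
    MulAction (G × Equiv.Perm (Fin n)) (FreeOp S n) where
  smul a := Quotient.map (fun t => NTree.map a.2 (NTree.gact a.1 t)) (fun _ _ h =>
    OpTree.Iso.map _ (OpTree.Iso.gact _ h))
  one_smul := by
    rintro ⟨t⟩
    exact sound_eq ((OpTree.map_id _).trans (OpTree.gact_one _))
  mul_smul := by
    rintro ⟨g, σ⟩ ⟨h, τ⟩ ⟨t⟩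
    refine sound_eq ?_
    simp only [NTree.map, NTree.gact, OpTree.gact_map, OpTree.map_map, Prod.mk_mul_mk,
      OpTree.gact_mul]
    rfl

/-- The symmetric sequence of the free operad. -/
def symSeq (S : SymSeq.{u, w} G) : SymSeq.{u, w} G where
  obj := FreeOp S

theorem smul_mk {n : ℕ} (g : G) (σ : Equiv.Perm (Fin n)) (t : NTree S n) :
    (g, σ) • mk t = mk (NTree.map σ (NTree.gact g t)) := rfl

theorem relabel_mk {m n : ℕ} (e : Fin m ≃ Fin n) (t : NTree S m) :
    (symSeq S).relabel e (mk t) = mk (NTree.map e t) := by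
  obtain rfl : m = n := Fin.equiv_iff_eq.1 ⟨e⟩
  refine (smul_mk 1 (e : Equiv.Perm (Fin m)) t).trans (sound_eq ?_)
  simp only [NTree.map, NTree.gact, OpTree.gact_one]

/-- Operadic composition: grafting of trees. -/
noncomputable def comp {k : ℕ} (j : Fin k → ℕ) (x : FreeOp S k) (y : ∀ i, FreeOp S (j i)) :
    FreeOp S (∑ i, j i) :=
  mk (NTree.graft x.out (fun i => (y i).out))

theorem comp_mk {k : ℕ} (j : Fin k → ℕ) (t : NTree S k) (u : ∀ i, NTree S (j i)) :
    comp j (mk t) (fun i => mk (u i)) = mk (NTree.graft t u) := by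
  refine sound (OpTree.Iso.bind (fun i => OpTree.Iso.map _ ?_) ?_)
  · exact Quotient.mk_out (s := NTree.setoid S _) (u i)
  · exact Quotient.mk_out (s := NTree.setoid S _) t

theorem smul_one (g : G) : (g, (1 : Equiv.Perm (Fin 1))) • (mk NTree.one : FreeOp S 1) =
    mk NTree.one := sound_eq rfl

theorem smul_comp {k : ℕ} (j : Fin k → ℕ) (g : G) (x : FreeOp S k) (y : ∀ i, FreeOp S (j i)) :
    (g, (1 : Equiv.Perm (Fin (∑ i, j i)))) • comp j x y =
      comp j ((g, (1 : Equiv.Perm (Fin k))) • x)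
        (fun i => (g, (1 : Equiv.Perm (Fin (j i)))) • y i) := by
  obtain ⟨t, rfl⟩ := exists_rep x
  choose u hu using fun i => exists_rep (y i)
  obtain rfl : (fun i => mk (u i)) = y := funext hu
  simp only [smul_mk, comp_mk]
  refine sound_eq ?_
  simp only [NTree.graft, NTree.map, NTree.gact, OpTree.gact_bind, OpTree.map_bind,
    OpTree.bind_map, OpTree.gact_map, OpTree.map_map]
  rfl

theorem perm_comp {k : ℕ} (j : Fin k → ℕ) (τ : Equiv.Perm (Fin k)) (x : FreeOp S k)
    (y : ∀ i, FreeOp S (j i)) :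
    comp j (((1 : G), τ) • x) y =
      (symSeq S).relabel (OperadIndex.blockPerm j τ)
        (comp (fun i => j (τ i)) x (fun i => y (τ i))) := by
  obtain ⟨t, rfl⟩ := exists_rep x
  choose u hu using fun i => exists_rep (y i)
  obtain rfl : (fun i => mk (u i)) = y := funext hu
  rw [smul_mk, comp_mk, comp_mk (fun i => j (τ i)) t (fun i => u (τ i)), relabel_mk]
  refine sound_eq ?_
  simp only [NTree.graft, NTree.map, NTree.gact, OpTree.gact_one, OpTree.map_bind,
    OpTree.bind_map, OpTree.map_map]
  congr 1
  funext i
  congr 1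
  funext p
  simp [OperadIndex.blockPerm]

theorem comp_perm {k : ℕ} (j : Fin k → ℕ) (σ : ∀ i, Equiv.Perm (Fin (j i))) (x : FreeOp S k)
    (y : ∀ i, FreeOp S (j i)) :
    comp j x (fun i => ((1 : G), σ i) • y i) = ((1 : G), OperadIndex.blockSum j σ) • comp j x y := by
  obtain ⟨t, rfl⟩ := exists_rep x
  choose u hu using fun i => exists_rep (y i)
  obtain rfl : (fun i => mk (u i)) = y := funext hu
  simp only [smul_mk, comp_mk]
  refine sound_eq ?_
  simp only [NTree.graft, NTree.map, NTree.gact, OpTree.gact_one, OpTree.map_bind,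
    OpTree.map_map]
  congr 1
  funext i
  congr 1
  funext p
  simp [OperadIndex.blockSum]

theorem one_comp {n : ℕ} (x : FreeOp S n) :
    (symSeq S).relabel (OperadIndex.leftUnit n)
      (comp (fun _ : Fin 1 => n) (mk NTree.one) (fun _ => x)) = x := by
  obtain ⟨t, rfl⟩ := exists_rep x
  rw [comp_mk, relabel_mk]
  refine sound_eq ?_
  simp only [NTree.graft, NTree.map, NTree.one, OpTree.bind, OpTree.map_map]
  conv_rhs => rw [← OpTree.map_id t.1]
  congr 1
  funext p
  simp only [OperadIndex.leftUnit, Function.comp, Equiv.trans_apply, Equiv.symm_apply_apply]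
  rfl

theorem comp_one {n : ℕ} (x : FreeOp S n) :
    (symSeq S).relabel (OperadIndex.rightUnit n)
      (comp (fun _ : Fin n => 1) x (fun _ => mk NTree.one)) = x := by
  obtain ⟨t, rfl⟩ := exists_rep x
  rw [comp_mk, relabel_mk]
  refine sound_eq ?_
  simp only [NTree.graft, NTree.map, NTree.one, OpTree.map, OpTree.map_bind]
  rw [OpTree.bind_leaf]
  conv_rhs => rw [← OpTree.map_id t.1]
  congr 1
  funext p
  simp [OperadIndex.rightUnit]

theorem comp_assoc {k : ℕ} (j : Fin k → ℕ) (l : ∀ i, Fin (j i) → ℕ) (x : FreeOp S k)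
    (y : ∀ i, FreeOp S (j i)) (z : ∀ i (p : Fin (j i)), FreeOp S (l i p)) :
    (symSeq S).relabel (OperadIndex.assoc j l)
        (comp (fun q => l (finSigmaFinEquiv.symm q).1 (finSigmaFinEquiv.symm q).2) (comp j x y)
          (fun q => z (finSigmaFinEquiv.symm q).1 (finSigmaFinEquiv.symm q).2)) =
      comp (fun i => ∑ p, l i p) x (fun i => comp (l i) (y i) (z i)) := by
  obtain ⟨t, rfl⟩ := exists_rep x
  choose u hu using fun i => exists_rep (y i)
  obtain rfl : (fun i => mk (u i)) = y := funext hu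
  choose r hr using fun i p => exists_rep (z i p)
  obtain rfl : (fun i p => mk (r i p)) = z := funext fun i => funext (hr i)
  simp only [comp_mk]
  rw [relabel_mk]
  refine sound_eq ?_
  simp only [NTree.graft, NTree.map, OpTree.map_bind, OpTree.bind_map, OpTree.map_map,
    OpTree.bind_bind]
  congr 1
  funext i
  congr 1
  funext p
  have key : ∀ (q : Fin (∑ i, j i)) (a : Σ i, Fin (j i)), finSigmaFinEquiv.symm q = a →
      OpTree.map (OperadIndex.assoc j l ∘ fun m => finSigmaFinEquiv ⟨q, m⟩)
        (r (finSigmaFinEquiv.symm q).1 (finSigmaFinEquiv.symm q).2).1 =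
      OpTree.map ((fun m => finSigmaFinEquiv ⟨a.1, m⟩) ∘ fun m => finSigmaFinEquiv ⟨a.2, m⟩)
        (r a.1 a.2).1 := by
    rintro q _ rfl
    congr 1
    funext m
    simp only [OperadIndex.assoc, Function.comp, Equiv.trans_apply, Equiv.symm_apply_apply]
    rfl
  exact key _ ⟨i, p⟩ (Equiv.symm_apply_apply _ _)

end FreeOp

/-- The free operad in `G`-sets on a symmetric sequence of `G`-sets. -/
noncomputable def freeOperad {G : Type u} [Group G] (S : SymSeq.{u, w} G) :
    GSetOperad.{u, w} G where
  toSymSeq := FreeOp.symSeq S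
  one := FreeOp.mk NTree.one
  comp := FreeOp.comp
  smul_one := FreeOp.smul_one
  smul_comp := FreeOp.smul_comp
  perm_comp := FreeOp.perm_comp
  comp_perm := FreeOp.comp_perm
  one_comp := FreeOp.one_comp
  comp_one := FreeOp.comp_one
  comp_assoc := FreeOp.comp_assoc

/-! ## The universal property of the free operad -/

/-- Maps of operads in `G`-sets. -/
structure GSetOperad.Hom {G : Type u} [Group G] (P : GSetOperad.{u, v} G)
    (Q : GSetOperad.{u, w} G) where
  toFun : ∀ n : ℕ, P.obj n → Q.obj n
  map_smul : ∀ (n : ℕ) (a : G × Equiv.Perm (Fin n)) (x : P.obj n),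
    toFun n (a • x) = a • toFun n x
  map_one : toFun 1 P.one = Q.one
  map_comp : ∀ {k : ℕ} (j : Fin k → ℕ) (x : P.obj k) (y : ∀ i, P.obj (j i)),
    toFun _ (P.comp j x y) = Q.comp j (toFun k x) (fun i => toFun (j i) (y i))

/-- The unit `S → 𝔽(S)`, which sends `s` to the corolla on `s`. -/
def FreeOp.unit {G : Type u} [Group G] {S : SymSeq.{u, w} G} {n : ℕ} (s : S.obj n) :
    (freeOperad S).obj n :=
  FreeOp.mk (NTree.corolla s)

theorem FreeOp.unit_smul {G : Type u} [Group G] {S : SymSeq.{u, w} G} {n : ℕ}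
    (a : G × Equiv.Perm (Fin n)) (s : S.obj n) :
    FreeOp.unit (a • s) = a • FreeOp.unit s := by
  obtain ⟨g, σ⟩ := a
  refine FreeOp.sound ?_
  have h := OpTree.Iso.node n σ ((g, (1 : Equiv.Perm (Fin n))) • s) OpTree.leaf
    (fun i => OpTree.leaf (σ i)) (fun i => .leaf _)
  simpa [← mul_smul, NTree.corolla, NTree.map, NTree.gact, OpTree.map, OpTree.gact] using h

namespace OperadIndex

theorem leftUnit_apply (n : ℕ) (i : Fin 1) (p : Fin n) :
    leftUnit n (finSigmaFinEquiv ⟨i, p⟩) = p := by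
  obtain rfl : i = 0 := Subsingleton.elim _ _
  simp only [leftUnit, Equiv.trans_apply, Equiv.symm_apply_apply]
  rfl

theorem rightUnit_apply (n : ℕ) (i : Fin n) (p : Fin 1) :
    rightUnit n (finSigmaFinEquiv ⟨i, p⟩) = i := by
  simp [rightUnit]

theorem assoc_apply {k : ℕ} (j : Fin k → ℕ) (l : ∀ i, Fin (j i) → ℕ) (q : Fin (∑ i, j i))
    (r : Fin (l (finSigmaFinEquiv.symm q).1 (finSigmaFinEquiv.symm q).2)) :
    assoc j l (finSigmaFinEquiv ⟨q, r⟩) = finSigmaFinEquiv ⟨(finSigmaFinEquiv.symm q).1,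
      finSigmaFinEquiv ⟨(finSigmaFinEquiv.symm q).2, r⟩⟩ := by
  simp only [assoc, Equiv.trans_apply, Equiv.symm_apply_apply]
  rfl

theorem sumCongr_apply {k : ℕ} {j j' : Fin k → ℕ} (e : ∀ i, Fin (j i) ≃ Fin (j' i)) (i : Fin k)
    (p : Fin (j i)) :
    (finSigmaFinEquiv.symm.trans ((Equiv.sigmaCongrRight e).trans finSigmaFinEquiv))
      (finSigmaFinEquiv ⟨i, p⟩) = finSigmaFinEquiv ⟨i, e i p⟩ := by
  simp

theorem blockCongr_apply {k m : ℕ} (j : Fin m → ℕ) (e : Fin k ≃ Fin m) (i : Fin k)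
    (p : Fin (j (e i))) :
    (finSigmaFinEquiv.symm.trans
      ((Equiv.sigmaCongrLeft (β := fun i => Fin (j i)) e).trans finSigmaFinEquiv))
      (finSigmaFinEquiv ⟨i, p⟩) = finSigmaFinEquiv ⟨e i, p⟩ := by
  simp

end OperadIndex

namespace SymSeq

variable {G : Type u} [Group G] (S : SymSeq.{u, w} G)

theorem relabel_perm {n : ℕ} (σ : Equiv.Perm (Fin n)) (x : S.obj n) :
    S.relabel σ x = ((1 : G), σ) • x := rfl

theorem relabel_refl {n : ℕ} (x : S.obj n) : S.relabel (Equiv.refl _) x = x :=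
  one_smul (G × Equiv.Perm (Fin n)) x

theorem relabel_relabel {k m n : ℕ} (e : Fin k ≃ Fin m) (f : Fin m ≃ Fin n) (x : S.obj k) :
    S.relabel f (S.relabel e x) = S.relabel (e.trans f) x := by
  obtain rfl : k = m := Fin.equiv_iff_eq.1 ⟨e⟩
  obtain rfl : k = n := Fin.equiv_iff_eq.1 ⟨f⟩
  refine (mul_smul (α := G × Equiv.Perm (Fin k)) _ _ _).symm.trans ?_
  rw [Prod.mk_mul_mk, mul_one]
  rfl

theorem smul_relabel {m n : ℕ} (g : G) (e : Fin m ≃ Fin n) (x : S.obj m) :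
    (g, (1 : Equiv.Perm (Fin n))) • S.relabel e x =
      S.relabel e ((g, (1 : Equiv.Perm (Fin m))) • x) := by
  obtain rfl : m = n := Fin.equiv_iff_eq.1 ⟨e⟩
  simp only [relabel_perm, ← mul_smul, Prod.mk_mul_mk, mul_one, one_mul]

end SymSeq

namespace GSetOperad

variable {G : Type u} [Group G] (P : GSetOperad.{u, v} G) {A B : Type}

theorem comp_relabel {k : ℕ} {j j' : Fin k → ℕ} (e : ∀ i, Fin (j i) ≃ Fin (j' i)) (x : P.obj k)
    (y : ∀ i, P.obj (j i)) :
    P.comp j' x (fun i => P.relabel (e i) (y i)) =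
      P.relabel (finSigmaFinEquiv.symm.trans ((Equiv.sigmaCongrRight e).trans finSigmaFinEquiv))
        (P.comp j x y) := by
  obtain rfl : j = j' := funext fun i => Fin.equiv_iff_eq.1 ⟨e i⟩
  exact P.comp_perm j e x y

theorem relabel_comp {k m : ℕ} (j : Fin m → ℕ) (e : Fin k ≃ Fin m) (x : P.obj k)
    (y : ∀ i, P.obj (j i)) :
    P.comp j (P.relabel e x) y =
      P.relabel (finSigmaFinEquiv.symm.trans
          ((Equiv.sigmaCongrLeft (β := fun i => Fin (j i)) e).trans finSigmaFinEquiv))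
        (P.comp (fun i => j (e i)) x (fun i => y (e i))) := by
  obtain rfl : k = m := Fin.equiv_iff_eq.1 ⟨e⟩
  exact P.perm_comp j e x y

/-- Operations of `P` with inputs labelled by elements of `A`. -/
structure Val (A : Type) where
  n : ℕ
  op : P.obj n
  lab : Fin n → A

namespace Val

variable {P}

/-- Equality of labelled operations up to renumbering the inputs. -/
def Rel (v v' : P.Val A) : Prop :=
  ∃ e : Fin v.n ≃ Fin v'.n, P.relabel e v.op = v'.op ∧ ∀ p, v'.lab (e p) = v.lab p

theorem Rel.refl (v : P.Val A) : Rel v v := ⟨Equiv.refl _, P.relabel_refl _, fun _ => rfl⟩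

theorem Rel.of_eq {v v' : P.Val A} (h : v = v') : Rel v v' := h ▸ Rel.refl v

theorem Rel.symm {v v' : P.Val A} : Rel v v' → Rel v' v := by
  rintro ⟨e, h, h'⟩
  refine ⟨e.symm, ?_, fun p => ?_⟩
  · rw [← h, P.relabel_relabel, Equiv.self_trans_symm, P.relabel_refl]
  · rw [← h', Equiv.apply_symm_apply]

theorem Rel.trans {v v' v'' : P.Val A} : Rel v v' → Rel v' v'' → Rel v v'' := by
  rintro ⟨e, h, h'⟩ ⟨f, k, k'⟩
  exact ⟨e.trans f, by rw [← P.relabel_relabel, h, k], fun p => by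
    rw [← h', ← k', Equiv.trans_apply]⟩

/-- Composition of an operation with labelled operations. -/
def bind {k : ℕ} (x : P.obj k) (v : Fin k → P.Val A) : P.Val A where
  n := ∑ i, (v i).n
  op := P.comp _ x (fun i => (v i).op)
  lab q := (v (finSigmaFinEquiv.symm q).1).lab (finSigmaFinEquiv.symm q).2

/-- Change of labels. -/
def map (f : A → B) (v : P.Val A) : P.Val B := ⟨v.n, v.op, fun p => f (v.lab p)⟩

/-- Substitution. -/
def join (v : P.Val A) (w : A → P.Val B) : P.Val B := bind v.op (fun i => w (v.lab i))

/-- The action of `G`. -/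
def gact (g : G) (v : P.Val A) : P.Val A := ⟨v.n, (g, (1 : Equiv.Perm (Fin v.n))) • v.op, v.lab⟩

theorem bind_lab {k : ℕ} (x : P.obj k) (v : Fin k → P.Val A) (i : Fin k) (p : Fin (v i).n) :
    (bind x v).lab (finSigmaFinEquiv ⟨i, p⟩) = (v i).lab p := by
  have key : ∀ q, q = (⟨i, p⟩ : Σ i, Fin (v i).n) → (v q.1).lab q.2 = (v i).lab p := by
    rintro _ rfl
    rfl
  exact key _ (Equiv.symm_apply_apply _ _)

theorem bind_congr {k : ℕ} (x : P.obj k) {v v' : Fin k → P.Val A} (h : ∀ i, Rel (v i) (v' i)) :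
    Rel (bind x v) (bind x v') := by
  choose e h h' using h
  refine ⟨finSigmaFinEquiv.symm.trans ((Equiv.sigmaCongrRight e).trans finSigmaFinEquiv), ?_, ?_⟩
  · exact (P.comp_relabel e x _).symm.trans (congrArg (P.comp _ x) (funext h))
  · intro q
    obtain ⟨⟨i, p⟩, rfl⟩ := finSigmaFinEquiv.surjective q
    refine Eq.trans ?_ ((h' i p).trans (bind_lab x v i p).symm)
    exact (congrArg _ (OperadIndex.sumCongr_apply e i p)).trans (bind_lab x v' i (e i p))

theorem bind_relabel {k m : ℕ} (e : Fin k ≃ Fin m) (x : P.obj k) (v : Fin m → P.Val A) :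
    Rel (bind (P.relabel e x) v) (bind x (fun i => v (e i))) := by
  refine Rel.symm ⟨finSigmaFinEquiv.symm.trans
    ((Equiv.sigmaCongrLeft (β := fun i => Fin (v i).n) e).trans finSigmaFinEquiv), ?_, ?_⟩
  · exact (P.relabel_comp (fun i => (v i).n) e x (fun i => (v i).op)).symm
  · intro q
    obtain ⟨⟨i, p⟩, rfl⟩ := finSigmaFinEquiv.surjective q
    refine Eq.trans ?_ (bind_lab x (fun i => v (e i)) i p).symm
    exact (congrArg _ (OperadIndex.blockCongr_apply (fun i => (v i).n) e i p)).trans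
      (bind_lab (P.relabel e x) v (e i) p)

theorem join_congr {v v' : P.Val A} {w w' : A → P.Val B} (h : Rel v v')
    (hw : ∀ a, Rel (w a) (w' a)) : Rel (join v w) (join v' w') := by
  obtain ⟨e, h, h'⟩ := h
  refine (bind_congr _ fun i => hw _).trans (Rel.symm ?_)
  unfold join
  rw [← h]
  refine (bind_relabel e v.op _).trans (Rel.of_eq ?_)
  simp only [h']

theorem map_congr (f : A → B) {v v' : P.Val A} (h : Rel v v') : Rel (map f v) (map f v') := by
  obtain ⟨e, h, h'⟩ := h
  exact ⟨e, h, fun p => congrArg f (h' p)⟩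

theorem gact_congr (g : G) {v v' : P.Val A} (h : Rel v v') : Rel (gact g v) (gact g v') := by
  obtain ⟨e, h, h'⟩ := h
  exact ⟨e, (P.smul_relabel g e v.op).symm.trans (congrArg _ h), h'⟩

theorem one_bind (v : P.Val A) : Rel (bind P.one (fun _ => v)) v :=
  ⟨OperadIndex.leftUnit v.n, P.one_comp v.op, fun q => by
    obtain ⟨⟨i, p⟩, rfl⟩ := finSigmaFinEquiv.surjective q
    obtain rfl : i = 0 := Subsingleton.elim _ _
    refine Eq.trans ?_ (bind_lab P.one (fun _ => v) 0 p).symm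
    exact congrArg v.lab (OperadIndex.leftUnit_apply v.n 0 p)⟩

theorem bind_one {n : ℕ} (x : P.obj n) (f : Fin n → A) :
    Rel (bind x (fun i => ⟨1, P.one, fun _ => f i⟩)) ⟨n, x, f⟩ :=
  ⟨OperadIndex.rightUnit n, P.comp_one x, fun q => by
    obtain ⟨⟨i, p⟩, rfl⟩ := finSigmaFinEquiv.surjective q
    refine Eq.trans ?_ (bind_lab x (fun i => ⟨1, P.one, fun _ => f i⟩) i p).symm
    exact congrArg f (OperadIndex.rightUnit_apply n i p)⟩

theorem bind_bind {k : ℕ} (x : P.obj k) (v : Fin k → P.Val A) (w : A → P.Val B) :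
    Rel (join (bind x v) w) (bind x (fun i => join (v i) w)) := by
  refine ⟨OperadIndex.assoc (fun i => (v i).n) (fun i p => (w ((v i).lab p)).n), ?_, ?_⟩
  · exact P.comp_assoc (fun i => (v i).n) (fun i p => (w ((v i).lab p)).n) x
      (fun i => (v i).op) (fun i p => (w ((v i).lab p)).op)
  · intro q
    obtain ⟨⟨a, r⟩, rfl⟩ := finSigmaFinEquiv.surjective q
    have h₁ := bind_lab (P.comp (fun i => (v i).n) x (fun i => (v i).op))
      (fun q => w ((v (finSigmaFinEquiv.symm q).1).lab (finSigmaFinEquiv.symm q).2)) a r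
    have h₂ := OperadIndex.assoc_apply (fun i => (v i).n) (fun i p => (w ((v i).lab p)).n) a r
    have h₃ := bind_lab x (fun i => join (v i) w) (finSigmaFinEquiv.symm a).1
      (finSigmaFinEquiv ⟨(finSigmaFinEquiv.symm a).2, r⟩)
    have h₄ := bind_lab (v (finSigmaFinEquiv.symm a).1).op
      (fun p => w ((v (finSigmaFinEquiv.symm a).1).lab p)) (finSigmaFinEquiv.symm a).2 r
    exact ((congrArg _ h₂).trans h₃).trans (h₄.trans h₁.symm)

theorem eq_of_rel {n : ℕ} {x y : P.obj n} (h : Rel (A := Fin n) ⟨n, x, id⟩ ⟨n, y, id⟩) : x = y := by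
  obtain ⟨e, h, h'⟩ := h
  obtain rfl : e = Equiv.refl _ := Equiv.ext h'
  exact (P.relabel_refl x).symm.trans h

end Val

end GSetOperad

namespace OpTree

open GSetOperad

variable {G : Type u} [Group G] {S : SymSeq.{u, w} G} {P : GSetOperad.{u, v} G} {A B : Type}

/-- Evaluate a tree in an operad. -/
def eval (φ : ∀ n, S.obj n → P.obj n) : OpTree S A → P.Val A
  | leaf a => ⟨1, P.one, fun _ => a⟩
  | node n s t => Val.bind (φ n s) (fun i => (t i).eval φ)

variable (φ : ∀ n, S.obj n → P.obj n)

theorem eval_map (f : A → B) :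
    ∀ t : OpTree S A, Val.Rel ((t.map f).eval φ) (Val.map f (t.eval φ))
  | leaf _ => .refl _
  | node n s t => Val.bind_congr (φ n s) (fun i => eval_map f (t i))

theorem eval_bind (f : A → OpTree S B) :
    ∀ t : OpTree S A, Val.Rel ((t.bind f).eval φ) (Val.join (t.eval φ) (fun a => (f a).eval φ))
  | leaf a => (Val.one_bind ((f a).eval φ)).symm
  | node n s t => (Val.bind_congr (φ n s) (fun i => eval_bind f (t i))).trans
      (Val.bind_bind (φ n s) (fun i => (t i).eval φ) (fun a => (f a).eval φ)).symm

theorem eval_gact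
    (hφ : ∀ n (a : G × Equiv.Perm (Fin n)) (s : S.obj n), φ n (a • s) = a • φ n s) (g : G) :
    ∀ t : OpTree S A, Val.Rel ((t.gact g).eval φ) (Val.gact g (t.eval φ))
  | leaf a => ⟨Equiv.refl _, (P.relabel_refl _).trans (P.smul_one g).symm, fun _ => rfl⟩
  | node n s t => by
    refine (Val.bind_congr _ (fun i => eval_gact hφ g (t i))).trans (Val.Rel.of_eq ?_)
    rw [hφ]
    exact congrArg (fun x => Val.mk (∑ i, ((t i).eval φ).n) x
      (Val.bind (φ n s) (fun i => (t i).eval φ)).lab)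
      (P.smul_comp (fun i => ((t i).eval φ).n) g (φ n s) (fun i => ((t i).eval φ).op)).symm

theorem eval_iso
    (hφ : ∀ n (a : G × Equiv.Perm (Fin n)) (s : S.obj n), φ n (a • s) = a • φ n s)
    {t t' : OpTree S A} (h : Iso t t') : Val.Rel (t.eval φ) (t'.eval φ) := by
  induction h with
  | leaf a => exact .refl _
  | node n σ s t t' _ ih =>
    simp only [eval, hφ]
    exact (Val.bind_relabel σ (φ n s) _).trans (Val.bind_congr (φ n s) ih)

theorem map_univ_sigma {k : ℕ} {j : Fin k → ℕ} (f : Fin (∑ i, j i) → A) :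
    Finset.univ.val.map f =
      ∑ i, Finset.univ.val.map (fun p : Fin (j i) => f (finSigmaFinEquiv ⟨i, p⟩)) := by
  have h := congrArg Finset.val
    (Finset.map_univ_equiv (finSigmaFinEquiv : (Σ i, Fin (j i)) ≃ Fin (∑ i, j i)))
  have h' : (Finset.univ.sigma fun i : Fin k => (Finset.univ : Finset (Fin (j i)))).val =
      Finset.univ.val.bind fun i => Finset.univ.val.map (Sigma.mk i) := rfl
  rw [← h, ← Finset.univ_sigma_univ, Finset.map_val, h', Multiset.map_bind, Multiset.map_bind]
  simp only [Multiset.map_map]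
  rfl

theorem eval_leaves :
    ∀ t : OpTree S A, Finset.univ.val.map (t.eval φ).lab = t.leaves
  | leaf a => rfl
  | node n s t => by
    simp only [leaves, ← eval_leaves]
    refine (map_univ_sigma (j := fun i => ((t i).eval φ).n) _).trans ?_
    refine Finset.sum_congr rfl fun i _ => Multiset.map_congr rfl fun p _ => ?_
    exact Val.bind_lab (φ n s) (fun i => (t i).eval φ) i p

theorem bijective_of_map_univ {m n : ℕ} (f : Fin m → Fin n)
    (h : Finset.univ.val.map f = Finset.univ.val) : Function.Bijective f := by
  constructor
  · have hn : (Finset.univ.val.map f).Nodup := h ▸ Finset.univ.nodup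
    intro a b hab
    exact Multiset.inj_on_of_nodup_map hn a (Finset.mem_univ a) b (Finset.mem_univ b) hab
  · intro b
    have hb : b ∈ Finset.univ.val.map f := h ▸ Finset.mem_univ b
    obtain ⟨a, _, ha⟩ := Multiset.mem_map.1 hb
    exact ⟨a, ha⟩

theorem exists_eval {n : ℕ} (t : NTree S n) :
    ∃ y : P.obj n, Val.Rel (t.1.eval φ) ⟨n, y, id⟩ := by
  have hb := bijective_of_map_univ _ ((eval_leaves φ t.1).trans t.2)
  exact ⟨P.relabel (Equiv.ofBijective _ hb) (t.1.eval φ).op, Equiv.ofBijective _ hb, rfl,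
    fun _ => rfl⟩

/-- Every tree arises from a tree with distinct leaf labels, and the values on the latter of maps
out of the free operad are determined by the values on corollas. -/
theorem exists_standard (f f' : GSetOperad.Hom (freeOperad S) P)
    (h : ∀ n (s : S.obj n), f.toFun n (FreeOp.unit s) = f'.toFun n (FreeOp.unit s)) :
    ∀ t : OpTree S A, ∃ (n : ℕ) (t₀ : NTree S n) (c : Fin n → A), t₀.1.map c = t ∧
      f.toFun n (FreeOp.mk t₀) = f'.toFun n (FreeOp.mk t₀)
  | leaf a => ⟨1, NTree.one, fun _ => a, rfl, f.map_one.trans f'.map_one.symm⟩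
  | node n s t => by
    choose m t₀ c h₁ h₂ using fun i => exists_standard f f' h (t i)
    refine ⟨_, NTree.graft (NTree.corolla s) t₀,
      fun q => c (finSigmaFinEquiv.symm q).1 (finSigmaFinEquiv.symm q).2, ?_, ?_⟩
    · simp only [NTree.graft, NTree.corolla, bind, map, map_map]
      congr 1
      funext i
      rw [← h₁ i]
      congr 1
      funext p
      have key : ∀ q, q = (⟨i, p⟩ : Σ i, Fin (m i)) → c q.1 q.2 = c i p := by
        rintro _ rfl
        rfl
      exact key _ (Equiv.symm_apply_apply _ _)
    · rw [← FreeOp.comp_mk]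
      refine (f.map_comp m (FreeOp.unit s) (fun i => FreeOp.mk (t₀ i))).trans ?_
      refine Eq.trans ?_ (f'.map_comp m (FreeOp.unit s) (fun i => FreeOp.mk (t₀ i))).symm
      rw [h, funext h₂]

end OpTree

theorem GSetOperad.Hom.map_relabel {G : Type u} [Group G] {P : GSetOperad.{u, v} G}
    {Q : GSetOperad.{u, w} G} (f : GSetOperad.Hom P Q) {m n : ℕ} (e : Fin m ≃ Fin n)
    (x : P.obj m) : f.toFun n (P.relabel e x) = Q.relabel e (f.toFun m x) := by
  obtain rfl : m = n := Fin.equiv_iff_eq.1 ⟨e⟩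
  exact f.map_smul m _ x

theorem freeOperad_hom_ext {G : Type u} [Group G] {S : SymSeq.{u, w} G}
    {P : GSetOperad.{u, v} G} (f f' : GSetOperad.Hom (freeOperad S) P)
    (h : ∀ n (s : S.obj n), f.toFun n (FreeOp.unit s) = f'.toFun n (FreeOp.unit s)) : f = f' := by
  have key : ∀ n (x : FreeOp S n), f.toFun n x = f'.toFun n x := by
    intro n x
    obtain ⟨t, rfl⟩ := FreeOp.exists_rep x
    obtain ⟨m, t₀, c, hc, h₀⟩ := OpTree.exists_standard f f' h t.1
    have hb : Function.Bijective c := OpTree.bijective_of_map_univ c (by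
      rw [← t₀.2, ← OpTree.leaves_map, hc, t.2])
    have ht : FreeOp.mk t = (freeOperad S).relabel (Equiv.ofBijective c hb) (FreeOp.mk t₀) := by
      refine Eq.trans (FreeOp.sound_eq ?_) (FreeOp.relabel_mk _ t₀).symm
      exact hc.symm
    rw [ht]
    refine (f.map_relabel _ _).trans (Eq.trans ?_ (f'.map_relabel _ _).symm)
    rw [h₀]
  obtain ⟨F, _, _, _⟩ := f
  obtain ⟨F', _, _, _⟩ := f'
  obtain rfl : F = F' := funext fun n => funext (key n)
  rfl

/-- The universal property of the free operad: every map of symmetric sequences from `S` to an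
operad extends uniquely to a map of operads. -/
theorem freeOperad_existsUnique {G : Type u} [Group G] (S : SymSeq.{u, w} G)
    (P : GSetOperad.{u, v} G) (φ : ∀ n, S.obj n → P.obj n)
    (hφ : ∀ n (a : G × Equiv.Perm (Fin n)) (s : S.obj n), φ n (a • s) = a • φ n s) :
    ∃! f : GSetOperad.Hom (freeOperad S) P, ∀ n (s : S.obj n), f.toFun n (FreeOp.unit s) = φ n s := by
  have ex : ∀ (n : ℕ) (x : FreeOp S n), ∃ y : P.obj n, ∀ t, FreeOp.mk t = x →
      GSetOperad.Val.Rel (t.1.eval φ) ⟨n, y, id⟩ := by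
    intro n x
    obtain ⟨t, rfl⟩ := FreeOp.exists_rep x
    obtain ⟨y, hy⟩ := OpTree.exists_eval φ t
    refine ⟨y, fun t' ht' => ?_⟩
    have h : OpTree.Iso t'.1 t.1 := Quotient.exact (s := NTree.setoid S n) ht'
    exact (OpTree.eval_iso φ hφ h).trans hy
  choose F hF using ex
  have uniq : ∀ {n : ℕ} (t : NTree S n) (y : P.obj n),
      GSetOperad.Val.Rel (t.1.eval φ) ⟨n, y, id⟩ → F n (FreeOp.mk t) = y := fun t y h =>
    GSetOperad.Val.eq_of_rel ((hF _ _ t rfl).symm.trans h)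
  refine ⟨⟨F, ?_, ?_, ?_⟩, ?_, ?_⟩
  · rintro n ⟨g, σ⟩ x
    obtain ⟨t, rfl⟩ := FreeOp.exists_rep x
    refine uniq (NTree.map σ (NTree.gact g t)) _ ?_
    refine (OpTree.eval_map φ σ _).trans (GSetOperad.Val.map_congr σ
      ((OpTree.eval_gact φ hφ g t.1).trans (GSetOperad.Val.gact_congr g (hF n _ t rfl)))|>.trans ?_)
    refine ⟨σ, ?_, fun _ => rfl⟩
    change ((1 : G), σ) • (g, (1 : Equiv.Perm (Fin n))) • F n (FreeOp.mk t) = _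
    rw [← mul_smul, Prod.mk_mul_mk, one_mul, mul_one]
  · refine uniq NTree.one _ ⟨Equiv.refl _, P.relabel_refl _, fun p => Subsingleton.elim _ _⟩
  · intro k j x y
    obtain ⟨t, rfl⟩ := FreeOp.exists_rep x
    choose r hr using fun i => FreeOp.exists_rep (y i)
    obtain rfl : (fun i => FreeOp.mk (r i)) = y := funext hr
    refine (congrArg (F _) (FreeOp.comp_mk j t r)).trans (uniq (NTree.graft t r) _ ?_)
    refine (OpTree.eval_bind φ _ t.1).trans ?_
    refine (GSetOperad.Val.join_congr (hF k _ t rfl) (fun i => (OpTree.eval_map φ _ (r i).1).trans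
      (GSetOperad.Val.map_congr _ (hF (j i) _ (r i) rfl)))).trans (GSetOperad.Val.Rel.of_eq ?_)
    refine congrArg (GSetOperad.Val.mk _ _) ?_
    funext q
    exact Equiv.apply_symm_apply finSigmaFinEquiv q
  · intro n s
    exact uniq (NTree.corolla s) _ (GSetOperad.Val.bind_one (φ n s) id)
  · intro f hf
    refine freeOperad_hom_ext f _ fun n s => (hf n s).trans ?_
    exact (uniq (NTree.corolla s) _ (GSetOperad.Val.bind_one (φ n s) id)).symm

/-! ## The generating symmetric sequence -/

/-- The graph `Γ_T = {(h, σ h) | h ∈ H} ≤ G × Σ_{|T|}` of an `H`-set `T` ordered by `e`. -/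
def FinAct.graph {G : Type u} [Group G] {H : Subgroup G} (T : FinAct H) {n : ℕ}
    (e : Fin n ≃ T.carrier) : Subgroup (G × Equiv.Perm (Fin n)) :=
  graphSubgroup H (T.permRep e)

/-- The generating operations: a unit `e`, a product `⊗`, and a norm `⨂_T` for every `T ∈ N`. -/
inductive NormGen {G : Type u} [Group G] (N : Exponents G) : Type (u + 1)
  | unit : NormGen N
  | tensor : NormGen N
  | norm (H : Subgroup G) (T : OrdFinAct H) (hT : T ∈ N H) : NormGen N

namespace NormGen

variable {G : Type u} [Group G] {N : Exponents G}

/-- The arity of a generating operation. -/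
def arity : NormGen N → ℕ
  | unit => 0
  | tensor => 2
  | norm _ T _ => T.card

/-- The stabilizer of a generating operation: `Γ_∅` for `e` and `Γ_{**}` for `⊗`, where `∅` and
`**` are `G`-sets with trivial action, and `Γ_T` for `⨂_T`. -/
def stab : ∀ c : NormGen N, Subgroup (G × Equiv.Perm (Fin c.arity))
  | unit => graphSubgroup (n := 0) ⊤ 1
  | tensor => graphSubgroup (n := 2) ⊤ 1
  | norm _ T _ => T.toFinAct.graph T.ordering

end NormGen

/-- The components of the graded coproduct of the orbits `(G × Σ_{|c|}) / Γ_c` of the generating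
operations `c`, the orbit of `c` being in degree `|c|`. -/
inductive NormSeqObj {G : Type u} [Group G] (N : Exponents G) : ℕ → Type (u + 1)
  | mk (c : NormGen N) (x : (G × Equiv.Perm (Fin c.arity)) ⧸ c.stab) : NormSeqObj N c.arity

/-- The generating symmetric sequence
`S_N = (G × Σ₀)/Γ_∅ ⊔ (G × Σ₂)/Γ_{**} ⊔ ∐_{T ∈ N} (G × Σ_{|T|})/Γ_T`. -/
def normSeq {G : Type u} [Group G] (N : Exponents G) : SymSeq.{u, u + 1} G where
  obj := NormSeqObj N
  action _ :=
    { smul := fun a x => match x with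
        | .mk c x => .mk c (a • x)
      one_smul := by
        rintro ⟨c, x⟩
        exact congrArg (NormSeqObj.mk c) (one_smul _ x)
      mul_smul := by
        rintro a b ⟨c, x⟩
        exact congrArg (NormSeqObj.mk c) (mul_smul a b x) }

/-! ## Operads in `G`-categories -/

/-- A symmetric sequence in `G`-categories: categories with a left `G × Σₙ`-action by functors. -/
structure GCatSymSeq (G : Type u) [Group G] where
  obj : ℕ → Type w
  [cat : ∀ n, Category.{v} (obj n)]
  act : ∀ {n : ℕ}, G × Equiv.Perm (Fin n) → obj n ⥤ obj n
  act_one : ∀ n : ℕ, act (1 : G × Equiv.Perm (Fin n)) = 𝟭 (obj n)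
  act_mul : ∀ {n : ℕ} (a b : G × Equiv.Perm (Fin n)), act (a * b) = act b ⋙ act a

attribute [instance] GCatSymSeq.cat

/-- Relabel the inputs along a bijection. For `m = n` this is the action of `Σₙ`, and for `m ≠ n`
there is no such bijection. -/
def GCatSymSeq.relabel {G : Type u} [Group G] (O : GCatSymSeq.{u, v, w} G) {m n : ℕ}
    (e : Fin m ≃ Fin n) : O.obj m ⥤ O.obj n := by
  obtain rfl : m = n := Fin.equiv_iff_eq.1 ⟨e⟩
  exact O.act ((1 : G), (e : Equiv.Perm (Fin m)))

/-- An operad in (small) `G`-categories, with the same conventions as for operads in `G`-sets. -/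
structure GCatOperad (G : Type u) [Group G] extends GCatSymSeq.{u, v, w} G where
  one : obj 1
  comp : ∀ {k : ℕ} (j : Fin k → ℕ), obj k × (∀ i, obj (j i)) ⥤ obj (∑ i, j i)
  /-- The unit is a `G`-fixed object. -/
  act_const_one : ∀ g : G, (act (g, (1 : Equiv.Perm (Fin 1)))).obj one = one
  act_comp : ∀ {k : ℕ} (j : Fin k → ℕ) (g : G),
    comp j ⋙ act (g, (1 : Equiv.Perm (Fin (∑ i, j i)))) =
      (act (g, (1 : Equiv.Perm (Fin k)))).prod
        (Functor.pi fun i => act (g, (1 : Equiv.Perm (Fin (j i))))) ⋙ comp j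
  perm_comp : ∀ {k : ℕ} (j : Fin k → ℕ) (τ : Equiv.Perm (Fin k)),
    (act ((1 : G), τ)).prod (𝟭 (∀ i, obj (j i))) ⋙ comp j =
      (𝟭 (obj k)).prod (Functor.pi' fun i => Pi.eval (fun i => obj (j i)) (τ i)) ⋙
        comp (fun i => j (τ i)) ⋙ toGCatSymSeq.relabel (OperadIndex.blockPerm j τ)
  comp_perm : ∀ {k : ℕ} (j : Fin k → ℕ) (σ : ∀ i, Equiv.Perm (Fin (j i))),
    (𝟭 (obj k)).prod (Functor.pi fun i => act ((1 : G), σ i)) ⋙ comp j =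
      comp j ⋙ act ((1 : G), OperadIndex.blockSum j σ)
  one_comp : ∀ n : ℕ,
    Functor.prod' ((Functor.const (obj n)).obj one) (Functor.pi' fun _ : Fin 1 => 𝟭 (obj n)) ⋙
      comp (fun _ : Fin 1 => n) ⋙ toGCatSymSeq.relabel (OperadIndex.leftUnit n) = 𝟭 (obj n)
  comp_one : ∀ n : ℕ,
    Functor.prod' (𝟭 (obj n)) (Functor.pi' fun _ : Fin n => (Functor.const (obj n)).obj one) ⋙
      comp (fun _ : Fin n => 1) ⋙ toGCatSymSeq.relabel (OperadIndex.rightUnit n) = 𝟭 (obj n)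
  /-- The associativity law, as an equality of functors on the category of all
  `(x, (yᵢ), (z_{i,p}))`. -/
  comp_assoc : ∀ {k : ℕ} (j : Fin k → ℕ) (l : ∀ i, Fin (j i) → ℕ),
    Functor.prod'
        (Functor.prod' (CategoryTheory.Prod.fst _ _) (CategoryTheory.Prod.snd _ _ ⋙ CategoryTheory.Prod.fst _ _) ⋙ comp j)
        (Functor.pi' fun q : Fin (∑ i, j i) => CategoryTheory.Prod.snd (obj k) _ ⋙ CategoryTheory.Prod.snd (∀ i, obj (j i)) _ ⋙
          Pi.eval (fun i => ∀ p : Fin (j i), obj (l i p)) (finSigmaFinEquiv.symm q).1 ⋙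
          Pi.eval (fun p => obj (l (finSigmaFinEquiv.symm q).1 p))
            (finSigmaFinEquiv.symm q).2) ⋙
        comp (fun q => l (finSigmaFinEquiv.symm q).1 (finSigmaFinEquiv.symm q).2) ⋙
        toGCatSymSeq.relabel (OperadIndex.assoc j l) =
      Functor.prod' (CategoryTheory.Prod.fst _ _)
        (Functor.pi' fun i =>
          Functor.prod'
            (CategoryTheory.Prod.snd (obj k) _ ⋙ CategoryTheory.Prod.fst _ _ ⋙ Pi.eval (fun i => obj (j i)) i)
            (CategoryTheory.Prod.snd (obj k) _ ⋙ CategoryTheory.Prod.snd _ _ ⋙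
              Pi.eval (fun i => ∀ p : Fin (j i), obj (l i p)) i) ⋙ comp (l i)) ⋙
        comp (fun i => ∑ p, l i p)

/-- Functors to a codiscrete category are determined by their values on objects. -/
theorem codiscrete_functor_ext {C : Type*} [Category* C] {A : Type*} {F F' : C ⥤ Codiscrete A}
    (h : ∀ c : C, (F.obj c).as = (F'.obj c).as) : F = F' :=
  CategoryTheory.Functor.ext (fun c => Codiscrete.ext (h c)) (fun _ _ _ => rfl)

/-- The chaotification of a symmetric sequence: every `S.obj n` becomes the chaotic category with
this set of objects, which has a unique morphism between any two objects. -/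
def SymSeq.chaotic {G : Type u} [Group G] (S : SymSeq.{u, w} G) : GCatSymSeq.{u, 0, w} G where
  obj n := Codiscrete (S.obj n)
  act a := Codiscrete.functor fun x => a • x.as
  act_one _ := codiscrete_functor_ext fun x => one_smul _ x.as
  act_mul a b := codiscrete_functor_ext fun x => mul_smul a b x.as

theorem SymSeq.chaotic_relabel {G : Type u} [Group G] (S : SymSeq.{u, w} G) {m n : ℕ}
    (e : Fin m ≃ Fin n) (x : Codiscrete (S.obj m)) :
    ((S.chaotic.relabel e).obj x).as = S.relabel e x.as := by
  obtain rfl : m = n := Fin.equiv_iff_eq.1 ⟨e⟩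
  rfl

/-- The chaotification of an operad in `G`-sets. -/
def GSetOperad.chaotic {G : Type u} [Group G] (P : GSetOperad.{u, w} G) :
    GCatOperad.{u, 0, w} G where
  toGCatSymSeq := P.toSymSeq.chaotic
  one := ⟨P.one⟩
  comp j := Codiscrete.functor fun x => P.comp j x.1.as (fun i => (x.2 i).as)
  act_const_one g := Codiscrete.ext (P.smul_one g)
  act_comp j g := codiscrete_functor_ext fun x => P.smul_comp j g x.1.as (fun i => (x.2 i).as)
  perm_comp j τ := codiscrete_functor_ext fun x =>
    (P.perm_comp j τ x.1.as (fun i => (x.2 i).as)).trans (P.chaotic_relabel _ _).symm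
  comp_perm j σ := codiscrete_functor_ext fun x => P.comp_perm j σ x.1.as (fun i => (x.2 i).as)
  one_comp _ := codiscrete_functor_ext fun x => (P.chaotic_relabel _ _).trans (P.one_comp x.as)
  comp_one _ := codiscrete_functor_ext fun x => (P.chaotic_relabel _ _).trans (P.comp_one x.as)
  comp_assoc j l := codiscrete_functor_ext fun x => (P.chaotic_relabel _ _).trans
    (P.comp_assoc j l x.1.as (fun i => (x.2.1 i).as) (fun i p => (x.2.2 i p).as))

/-- The operad `SM_N`, the chaotification of the free operad on the symmetric sequence `S_N`. -/
noncomputable def normedSMOperad {G : Type u} [Group G] (N : Exponents G) :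
    GCatOperad.{u, 0, u + 1} G :=
  (freeOperad (normSeq N)).chaotic

/-! ## `N∞` operads and admissible sets -/

/-- The classifying space of a category: the geometric realization of its nerve. -/
noncomputable def classifyingSpace (C : Type w) [Category.{v} C] : TopCat.{max v w} :=
  SSet.toTop.obj (nerve C)

/-- The map of classifying spaces induced by a functor. -/
noncomputable def classifyingSpaceMap {C : Type w} [Category.{v} C] (F : C ⥤ C) :
    C(classifyingSpace C, classifyingSpace C) :=
  (SSet.toTop.map (nerveMap F)).hom

namespace GCatSymSeq

variable {G : Type u} [Group G] (O : GCatSymSeq.{u, v, w} G)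

/-- The space `B O(n)`. -/
noncomputable abbrev space (n : ℕ) : TopCat.{max v w} := classifyingSpace (O.obj n)

/-- The action of `G × Σₙ` on `B O(n)`. -/
noncomputable instance spaceAction (n : ℕ) :
    MulAction (G × Equiv.Perm (Fin n)) (O.space n) where
  smul a x := classifyingSpaceMap (O.act a) x
  one_smul x := by
    change (SSet.toTop.map (nerveMap (O.act 1))).hom x = x
    rw [O.act_one]
    have h : nerveMap (𝟭 (O.obj n)) = 𝟙 (nerve (O.obj n)) := rfl
    rw [h, CategoryTheory.Functor.map_id]
    rfl
  mul_smul a b x := by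
    change (SSet.toTop.map (nerveMap (O.act (a * b)))).hom x =
      (SSet.toTop.map (nerveMap (O.act a))).hom ((SSet.toTop.map (nerveMap (O.act b))).hom x)
    rw [O.act_mul]
    have h : nerveMap (O.act b ⋙ O.act a) = nerveMap (O.act b) ≫ nerveMap (O.act a) := rfl
    rw [h, CategoryTheory.Functor.map_comp]
    rfl

end GCatSymSeq

/-- A family of subgroups: a class of subgroups closed under passage to subgroups and conjugates. -/
structure IsSubgroupFamily {Γ : Type*} [Group Γ] (F : Set (Subgroup Γ)) : Prop where
  le_mem : ∀ Λ ∈ F, ∀ Λ' ≤ Λ, Λ' ∈ F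
  conj_mem : ∀ Λ ∈ F, ∀ g : Γ, Λ.map (MulAut.conj g).toMonoidHom ∈ F

/-- `X` is a universal space for the family `F`: the fixed point space `X^Λ` is contractible for
`Λ ∈ F` and empty for `Λ ∉ F`. -/
def IsUniversalSpace {Γ : Type*} [Group Γ] (F : Set (Subgroup Γ)) (X : Type*)
    [TopologicalSpace X] [MulAction Γ X] : Prop :=
  ∀ Λ : Subgroup Γ, (Λ ∈ F → ContractibleSpace (MulAction.fixedPoints Λ X)) ∧
    (Λ ∉ F → MulAction.fixedPoints Λ X = ∅)

/-- `X` is equivariantly contractible: there is an equivariant homotopy from the identity to the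
constant map at a fixed point. -/
def IsEquivariantlyContractible (Γ : Type*) [Group Γ] (X : Type*)
    [TopologicalSpace X] [MulAction Γ X] : Prop :=
  ∃ x₀ ∈ MulAction.fixedPoints Γ X,
    ∃ h : (ContinuousMap.id X).Homotopy (ContinuousMap.const X x₀),
      ∀ (g : Γ) (t : unitInterval) (x : X), h (t, g • x) = g • h (t, x)

namespace GCatOperad

variable {G : Type u} [Group G] (O : GCatOperad.{u, v, w} G)

/-- A categorical `N∞` operad: an operad in `G`-categories whose levelwise classifying space is an
`N∞` operad in `G`-spaces. Only the spaces `B O(n)` and their `G × Σₙ`-actions enter here. -/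
structure IsNInfty : Prop where
  /-- `B O(0)` is `G`-contractible (here `Σ₀` is trivial). -/
  contractible : IsEquivariantlyContractible (G × Equiv.Perm (Fin 0)) (O.space 0)
  /-- `Σₙ` acts freely on `B O(n)`. -/
  free : ∀ (n : ℕ) (σ : Equiv.Perm (Fin n)) (x : O.space n), ((1 : G), σ) • x = x → σ = 1
  /-- `B O(n)` is a universal space for a family of subgroups of `G × Σₙ` that contains all
  subgroups `H × 1`. -/
  universal : ∀ n : ℕ, ∃ F : Set (Subgroup (G × Equiv.Perm (Fin n))),
    IsSubgroupFamily F ∧ (∀ H : Subgroup G, H.prod ⊥ ∈ F) ∧ IsUniversalSpace F (O.space n)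

/-- The graded class of admissible sets: a finite `H`-set `T` is admissible if `B O(|T|)` has a
`Γ_T`-fixed point, for an ordering of `T`. -/
def admissible : GradedClass G :=
  fun _ => {T | ∃ (n : ℕ) (e : Fin n ≃ T.carrier),
    (MulAction.fixedPoints (T.graph e) (O.space n)).Nonempty}

end GCatOperad

/-!
The theorem has a topological part, which reduces all assertions to fixed points in the free operad
`𝔽(S_N)`, and a combinatorial part about labelled trees.

*Classifying spaces.* Let `A` be a set and `X` the classifying space of the chaotic category on `A`.
A map out of a geometric realization is the same as a compatible family of maps on cells. This gives
two constructions that are natural in `A`. First, sending a point in the interior of the simplex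
`(a₀, …, aₙ)` to `a₀` is an equivariant (discontinuous) map `X → A`, so that a fixed point in `X`
gives a fixed point in `A` (`Realization.exists_equivariant_retraction`). Second, coning off with
`a ∈ A` contracts `X` onto `a`, compatibly with all symmetries that fix `a`
(`Realization.exists_equivariant_contraction`). Hence `X` is universal for the family of the
subgroups that fix an element of `A`, and `GSetOperad.chaotic_isNInfty` leaves two facts about
`𝔽(S_N)` to be checked: the symmetric groups act freely, because they do so on `S_N` and a tree then
has no automorphisms (`FreeOp.perm_eq_one`), and there are `G`-fixed operations of every arity,
namely iterated tensor products.

*Admissible sets form an indexing system.* An `H`-set is admissible if and only if it is the set of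
leaves of a tree whose isomorphism class is `H`-equivariant (`freeOperad_mem_admissible_iff`).
Grafting an equivariant family of trees onto the leaves of such a tree (`IsTreeFor.bind`) gives
products, self-induction and, by grafting copies of the unit `e`, subobjects. Coproducts come from
`⊗`, and corollas on the norms show that `N` consists of admissible sets.

*Minimality.* Let `F` be an indexing system that contains `N`. Then `F` is determined by its
transfers `K → H`, meaning that `H/K ∈ F`: an `H`-set is in `F` if and only if the stabilizers of its
points transfer to `H`, and the transfer relation is reflexive, transitive and closed under
restriction. In a tree with symmetries by `H`, the branches above the root are permuted by `H`
through the stabilizer of the label of the root, which is the graph of a conjugate of a generating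
action, so the stabilizer of a branch transfers to `H`. By induction on the tree and transitivity,
the stabilizer of each leaf transfers to `H` (`isTransfer_pointStab`). So all admissible sets are in
`F`.
-/

/-! ### Cells of geometric realizations -/

namespace Realization

open Opposite Simplicial

variable {X Y : SSet.{w}}

/-- The characteristic map `Δⁿ → |X|` of an `n`-simplex of a simplicial set `X`: the unit of the
adjunction between geometric realization and singular simplicial sets. -/
noncomputable def cell {n : SimplexCategory} (x : X.obj (op n)) :
    C(stdSimplex ℝ (Fin (n.len + 1)), SSet.toTop.obj X) :=
  TopCat.toSSetObjEquiv _ _ ((sSetTopAdj.unit.app X).app (op n) x)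

theorem cell_map {m n : SimplexCategory} (θ : m ⟶ n) (x : X.obj (op n))
    (z : stdSimplex ℝ (Fin (m.len + 1))) :
    cell (X.map θ.op x) z = cell x (stdSimplex.map θ z) := by
  have h := NatTrans.naturality_apply (sSetTopAdj.unit.app X) θ.op x
  exact (congrArg (fun y => TopCat.toSSetObjEquiv _ _ y z) h).trans
    (TopCat.toSSetObjEquiv_naturality_apply θ _ z)

theorem toTop_map_cell (f : X ⟶ Y) {n : SimplexCategory} (x : X.obj (op n))
    (z : stdSimplex ℝ (Fin (n.len + 1))) :
    SSet.toTop.map f (cell x z) = cell (f.app _ x) z := by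
  have h := ConcreteCategory.congr_hom (NatTrans.congr_app (sSetTopAdj.unit.naturality f) (op n)) x
  exact (congrArg (fun y => TopCat.toSSetObjEquiv _ _ y z) h).symm

theorem hom_ext_cell {T : TopCat.{w}} {f g : SSet.toTop.obj X ⟶ T}
    (h : ∀ (n : SimplexCategory) (x : X.obj (op n)) z, f (cell x z) = g (cell x z)) : f = g := by
  apply (sSetTopAdj.homEquiv X T).injective
  ext ⟨n⟩ x
  apply (TopCat.toSSetObjEquiv _ _).injective
  ext z
  exact h n x z

/-- The geometric realization is the union of its cells. The proof compares two maps to the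
two-point indiscrete space. -/
theorem cell_surjective (p : SSet.toTop.obj X) :
    ∃ (n : SimplexCategory) (x : X.obj (op n)) (z : _), cell x z = p := by
  let _ : TopologicalSpace (ULift.{w} Prop) := ⊤
  let f : SSet.toTop.obj X ⟶ TopCat.of (ULift.{w} Prop) :=
    TopCat.ofHom ⟨fun p => ⟨∃ (n : SimplexCategory) (x : X.obj (op n)) (z : _), cell x z = p⟩,
      continuous_top⟩
  let g : SSet.toTop.obj X ⟶ TopCat.of (ULift.{w} Prop) :=
    TopCat.ofHom ⟨fun _ => ⟨True⟩, continuous_top⟩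
  have h : f = g := hom_ext_cell fun n x z =>
    congrArg ULift.up (eq_true ⟨n, x, z, rfl⟩)
  have hp := congrArg ULift.down (ConcreteCategory.congr_hom h p)
  exact of_eq_true hp

/-- A compatible family of maps on the cells defines a map on the geometric realization. -/
theorem exists_map_of_cells {T : Type w} [TopologicalSpace T]
    (c : ∀ (n : SimplexCategory), X.obj (op n) → C(stdSimplex ℝ (Fin (n.len + 1)), T))
    (hc : ∀ {m n : SimplexCategory} (θ : m ⟶ n) (x : X.obj (op n)) z,
      c m (X.map θ.op x) z = c n x (stdSimplex.map θ z)) :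
    ∃ f : C(SSet.toTop.obj X, T), ∀ (n : SimplexCategory) (x : X.obj (op n)) z,
      f (cell x z) = c n x z := by
  let φ : X ⟶ TopCat.toSSet.obj (TopCat.of T) :=
    { app n := ↾fun x => (TopCat.toSSetObjEquiv (TopCat.of T) n).symm (c n.unop x)
      naturality := by
        rintro ⟨n⟩ ⟨m⟩ θ
        ext x
        apply (TopCat.toSSetObjEquiv _ _).injective
        ext z
        exact hc θ.unop x z }
  refine ⟨((sSetTopAdj.homEquiv X (TopCat.of T)).symm φ).hom, fun n x z => ?_⟩
  have h := ConcreteCategory.congr_hom (NatTrans.congr_app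
    ((sSetTopAdj.homEquiv X (TopCat.of T)).apply_symm_apply φ) (op n)) x
  exact congrArg (fun y => TopCat.toSSetObjEquiv (TopCat.of T) _ y z) h

/-- A compatible family of arbitrary functions on the cells defines a function on the geometric
realization. -/
theorem exists_function_of_cells {T : Type w}
    (c : ∀ (n : SimplexCategory), X.obj (op n) → stdSimplex ℝ (Fin (n.len + 1)) → T)
    (hc : ∀ {m n : SimplexCategory} (θ : m ⟶ n) (x : X.obj (op n)) z,
      c m (X.map θ.op x) z = c n x (stdSimplex.map θ z)) :
    ∃ f : SSet.toTop.obj X → T, ∀ (n : SimplexCategory) (x : X.obj (op n)) z,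
      f (cell x z) = c n x z := by
  -- Every function to an indiscrete space is continuous.
  let _ : TopologicalSpace T := ⊤
  obtain ⟨f, hf⟩ := exists_map_of_cells (fun n x => ⟨c n x, continuous_top⟩) hc
  exact ⟨f, hf⟩

end Realization

/-! ### Classifying spaces of chaotic categories -/

namespace Realization

open Opposite Simplicial

/-- The first vertex of a simplex on which a point has a positive barycentric coordinate. -/
noncomputable def firstVertex {n : ℕ} (z : stdSimplex ℝ (Fin (n + 1))) : Fin (n + 1) :=
  sInf {i | 0 < z i}

theorem exists_pos {n : ℕ} (z : stdSimplex ℝ (Fin (n + 1))) : {i | 0 < z i}.Nonempty := by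
  by_contra h
  have h0 : ∀ i, z i = 0 := fun i =>
    le_antisymm (not_lt.1 fun hi => h ⟨i, hi⟩) (stdSimplex.zero_le z i)
  have h1 := stdSimplex.sum_eq_one z
  simp [h0] at h1

/-- Since simplicial operators are monotone, they preserve the first vertex of the support. -/
theorem firstVertex_map {m n : ℕ} (θ : Fin (m + 1) →o Fin (n + 1))
    (z : stdSimplex ℝ (Fin (m + 1))) :
    firstVertex (stdSimplex.map θ z) = θ (firstVertex z) := by
  have hpos : ∀ j, 0 < stdSimplex.map θ z j ↔ ∃ i, θ i = j ∧ 0 < z i := by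
    intro j
    rw [stdSimplex.map_coe, FunOnFinite.linearMap_apply_apply]
    rw [Finset.sum_pos_iff_of_nonneg fun i _ => stdSimplex.zero_le z i]
    simp
  have hz : 0 < z (firstVertex z) := csInf_mem (exists_pos z)
  refine le_antisymm (csInf_le (OrderBot.bddBelow _) ((hpos _).2 ⟨_, rfl, hz⟩)) ?_
  obtain ⟨i, hi, hi0⟩ := (hpos _).1 (csInf_mem (exists_pos (stdSimplex.map θ z)))
  refine le_of_le_of_eq (θ.monotone ?_) hi
  exact csInf_le (OrderBot.bddBelow _) hi0

/-- The classifying space of a chaotic category maps to its set of objects, compatibly with all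
functors: a point in the interior of the simplex `(a₀, …, aₙ)` goes to `a₀`. (The map is not
continuous.) -/
theorem exists_equivariant_retraction (A : Type w) :
    ∃ r : classifyingSpace (Codiscrete A) → Codiscrete A,
      ∀ (F : Codiscrete A ⥤ Codiscrete A) (p : classifyingSpace (Codiscrete A)),
        r (classifyingSpaceMap F p) = F.obj (r p) := by
  obtain ⟨r, hr⟩ := exists_function_of_cells (X := nerve (Codiscrete A))
    (fun n x z => (show ComposableArrows _ n.len from x).obj (firstVertex z)) (by
      intro m n θ x z
      exact congrArg x.obj (firstVertex_map θ.toOrderHom z).symm)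
  refine ⟨r, fun F p => ?_⟩
  obtain ⟨n, x, z, rfl⟩ := cell_surjective p
  have h : classifyingSpaceMap F (cell x z) = cell ((nerveMap F).app _ x) z :=
    toTop_map_cell (nerveMap F) x z
  rw [h, hr, hr]
  rfl

/-- The point `(s, (1 - s) z₀, …, (1 - s) zₙ)` of the cone on a simplex. -/
def conePoint {n : ℕ} (z : stdSimplex ℝ (Fin (n + 1))) (s : unitInterval) :
    stdSimplex ℝ (Fin (n + 1 + 1)) :=
  ⟨Fin.cons (s : ℝ) fun i => (1 - (s : ℝ)) * z i, by
    refine ⟨fun i => ?_, ?_⟩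
    · refine Fin.cases s.2.1 (fun i => ?_) i
      exact mul_nonneg (sub_nonneg.2 s.2.2) (stdSimplex.zero_le z i)
    · rw [Fin.sum_univ_succ]
      simp only [Fin.cons_zero, Fin.cons_succ, ← Finset.mul_sum]
      rw [stdSimplex.sum_eq_one z]
      ring⟩

theorem continuous_conePoint (n : ℕ) :
    Continuous fun p : stdSimplex ℝ (Fin (n + 1)) × unitInterval => conePoint p.1 p.2 := by
  refine Continuous.subtype_mk (continuous_pi fun i => ?_) _
  refine Fin.cases ?_ (fun i => ?_) i
  · exact continuous_subtype_val.comp continuous_snd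
  · refine (continuous_const.sub (continuous_subtype_val.comp continuous_snd)).mul ?_
    exact (continuous_apply i).comp (continuous_subtype_val.comp continuous_fst)

/-- The extension of a simplicial operator to cones. -/
def coneHom {m n : SimplexCategory} (θ : m ⟶ n) : ⦋m.len + 1⦌ ⟶ ⦋n.len + 1⦌ :=
  SimplexCategory.Hom.mk
    { toFun := Fin.cons 0 fun i => (θ.toOrderHom i).succ
      monotone' := by
        intro i j
        refine Fin.cases (fun _ => Fin.zero_le _) (fun i => ?_) i
        refine Fin.cases (fun h => ?_) (fun j h => ?_) j
        · exact absurd h (by simp)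
        · simpa using θ.toOrderHom.monotone (Fin.succ_le_succ_iff.1 h) }

theorem map_conePoint {m n : SimplexCategory} (θ : m ⟶ n) (z : stdSimplex ℝ (Fin (m.len + 1)))
    (s : unitInterval) :
    stdSimplex.map (coneHom θ) (conePoint z s) = conePoint (stdSimplex.map θ z) s := by
  ext j
  rw [stdSimplex.map_coe, FunOnFinite.linearMap_apply_apply, Finset.sum_filter, Fin.sum_univ_succ]
  refine Fin.cases ?_ (fun j => ?_) j
  · have h : ∀ i : Fin (m.len + 1), ((coneHom θ) i.succ : Fin (n.len + 1 + 1)) ≠ 0 :=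
      fun i => Fin.succ_ne_zero _
    refine Eq.trans (congrArg₂ (· + ·) (if_pos rfl)
      (Finset.sum_eq_zero fun i _ => if_neg (h i))) (add_zero _)
  · have h0 : ¬ ((coneHom θ) (0 : Fin (m.len + 1 + 1)) : Fin (n.len + 1 + 1)) = j.succ :=
      (Fin.succ_ne_zero j).symm
    have h1 : conePoint (stdSimplex.map θ z) s j.succ
        = (1 - (s : ℝ)) * ∑ i with θ i = j, z i := by
      rw [← FunOnFinite.linearMap_apply_apply ℝ ℝ θ, ← stdSimplex.map_coe]
      rfl
    rw [if_neg h0, h1, zero_add, Finset.mul_sum, Finset.sum_filter]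
    refine Finset.sum_congr rfl fun i _ => ?_
    have h2 : ((coneHom θ) i.succ : Fin (n.len + 1 + 1)) = j.succ ↔ θ i = j :=
      (Fin.succ_injective _).eq_iff
    by_cases h : θ i = j
    · rw [if_pos h, if_pos (h2.2 h)]
      rfl
    · rw [if_neg h, if_neg fun h' => h (h2.1 h')]

theorem conePoint_zero {n : ℕ} (z : stdSimplex ℝ (Fin (n + 1))) :
    conePoint z 0 = stdSimplex.map Fin.succ z := by
  ext j
  rw [stdSimplex.map_coe, FunOnFinite.linearMap_apply_apply, Finset.sum_filter]
  refine Fin.cases ?_ (fun j => ?_) j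
  · refine Eq.trans ?_ (Finset.sum_eq_zero fun i _ => if_neg (Fin.succ_ne_zero i)).symm
    rfl
  · simp only [Fin.succ_inj, Finset.sum_ite_eq', Finset.mem_univ, if_true]
    change (1 - ((0 : unitInterval) : ℝ)) * z j = z j
    simp

theorem conePoint_one {n : ℕ} (z : stdSimplex ℝ (Fin (n + 1))) :
    conePoint z 1 = stdSimplex.map (fun _ : Fin 1 => 0) default := by
  ext j
  rw [stdSimplex.map_coe, FunOnFinite.linearMap_apply_apply, Finset.sum_filter]
  refine Fin.cases ?_ (fun j => ?_) j
  · simp only [if_true, Finset.univ_unique, Finset.sum_singleton, stdSimplex.eq_one_of_unique]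
    rfl
  · rw [Finset.sum_eq_zero fun i _ => if_neg (Fin.succ_ne_zero j).symm]
    change (1 - ((1 : unitInterval) : ℝ)) * z j = 0
    simp

/-- The simplex `(a, a₀, …, aₙ)`. -/
def consSimplex {A : Type w} (a : A) {n : SimplexCategory}
    (x : (nerve (Codiscrete A)).obj (op n)) :
    (nerve (Codiscrete A)).obj (op ⦋n.len + 1⦌) :=
  Codiscrete.functor (Fin.cons (α := fun _ => A) a fun i => ((show ComposableArrows _ n.len from x).obj i).as)

theorem consSimplex_map {A : Type w} (a : A) {m n : SimplexCategory} (θ : m ⟶ n)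
    (x : (nerve (Codiscrete A)).obj (op n)) :
    consSimplex a ((nerve (Codiscrete A)).map θ.op x) =
      (nerve (Codiscrete A)).map (coneHom θ).op (consSimplex a x) := by
  refine codiscrete_functor_ext fun i => ?_
  exact Fin.cases rfl (fun i => rfl) i

theorem nerveMap_consSimplex {A : Type w} {a : A} {F : Codiscrete A ⥤ Codiscrete A}
    (hF : (F.obj ⟨a⟩).as = a) {n : SimplexCategory} (x : (nerve (Codiscrete A)).obj (op n)) :
    (nerveMap F).app _ (consSimplex a x) = consSimplex a ((nerveMap F).app _ x) := by
  refine codiscrete_functor_ext fun i => ?_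
  exact Fin.cases hF (fun i => rfl) i

/-- The classifying space of a chaotic category contracts onto any object `a` by the straight-line
homotopies in the simplices `(a, a₀, …, aₙ)`. This contraction is compatible with all functors that
fix `a`. It is constructed as a map to the path space, and this only requires maps on cells. -/
theorem exists_equivariant_contraction {A : Type w} (a : A) :
    ∃ (x₀ : classifyingSpace (Codiscrete A))
      (h : (ContinuousMap.id (classifyingSpace (Codiscrete A))).Homotopy
        (ContinuousMap.const _ x₀)),
      ∀ F : Codiscrete A ⥤ Codiscrete A, (F.obj ⟨a⟩).as = a →
        classifyingSpaceMap F x₀ = x₀ ∧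
        ∀ t x, h (t, classifyingSpaceMap F x) = classifyingSpaceMap F (h (t, x)) := by
  let X := nerve (Codiscrete A)
  let c : ∀ n : SimplexCategory, X.obj (op n) → C(stdSimplex ℝ (Fin (n.len + 1)),
      C(unitInterval, classifyingSpace (Codiscrete A))) := fun n x =>
    ContinuousMap.curry ((cell (consSimplex a x)).comp ⟨_, continuous_conePoint n.len⟩)
  obtain ⟨f, hf⟩ := exists_map_of_cells (X := X) c (by
    intro m n θ x z
    ext s
    change cell (consSimplex a (X.map θ.op x)) (conePoint z s) =
      cell (consSimplex a x) (conePoint (stdSimplex.map θ z) s)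
    rw [consSimplex_map, cell_map, map_conePoint])
  have hf' : ∀ (n : SimplexCategory) (x : X.obj (op n)) z s,
      f (cell x z) s = cell (consSimplex a x) (conePoint z s) := fun n x z s =>
    congrArg (fun p : C(unitInterval, classifyingSpace (Codiscrete A)) => p s) (hf n x z)
  have hF : ∀ (F : Codiscrete A ⥤ Codiscrete A) (n : SimplexCategory) (x : X.obj (op n)) z,
      classifyingSpaceMap F (cell x z) = cell ((nerveMap F).app _ x) z :=
    fun F n x z => toTop_map_cell (nerveMap F) x z
  let v : X.obj (op ⦋0⦌) := Codiscrete.functor fun _ => a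
  refine ⟨cell v default, ⟨⟨fun p => f p.2 p.1, ?_⟩, fun p => ?_, fun p => ?_⟩,
    fun F hFa => ⟨?_, fun t p => ?_⟩⟩
  · exact (f.continuous.comp continuous_snd).eval continuous_fst
  · obtain ⟨n, x, z, rfl⟩ := cell_surjective p
    refine (hf' n x z 0).trans ?_
    rw [conePoint_zero]
    let δ : n ⟶ ⦋n.len + 1⦌ := SimplexCategory.Hom.mk (Fin.succOrderEmb _).toOrderHom
    refine (cell_map δ (consSimplex a x) z).symm.trans ?_
    refine congrArg (fun y => cell y z) (codiscrete_functor_ext fun i => rfl)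
  · obtain ⟨n, x, z, rfl⟩ := cell_surjective p
    refine (hf' n x z 1).trans ?_
    rw [conePoint_one]
    let δ : ⦋0⦌ ⟶ ⦋n.len + 1⦌ := SimplexCategory.Hom.mk ⟨fun _ => 0, fun _ _ _ => le_rfl⟩
    refine (cell_map δ (consSimplex a x) default).symm.trans ?_
    refine congrArg (fun y => cell y default) (codiscrete_functor_ext fun i => rfl)
  · rw [hF]
    exact congrArg (fun y => cell y default) (codiscrete_functor_ext fun i => hFa)
  · obtain ⟨n, x, z, rfl⟩ := cell_surjective p
    change f (classifyingSpaceMap F (cell x z)) t = classifyingSpaceMap F (f (cell x z) t)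
    rw [hF, hf', hf', hF, nerveMap_consSimplex hFa]

end Realization

namespace SymSeq

variable {G : Type u} [Group G] (S : SymSeq.{u, w} G) {n : ℕ}

/-- A point of the classifying space that is fixed by a set of group elements gives an operation
that is fixed by them. -/
theorem exists_fixed_of_chaotic_fixed (p : S.chaotic.space n) :
    ∃ x : S.obj n, ∀ a : G × Equiv.Perm (Fin n), a • p = p → a • x = x := by
  obtain ⟨r, hr⟩ := Realization.exists_equivariant_retraction (S.obj n)
  refine ⟨(r p).as, fun a ha => ?_⟩
  have h := (hr (S.chaotic.act a) p).symm.trans (congrArg r ha)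
  exact congrArg Codiscrete.as h

theorem exists_chaotic_contraction (x : S.obj n) :
    ∃ (x₀ : S.chaotic.space n)
      (h : (ContinuousMap.id (S.chaotic.space n)).Homotopy (ContinuousMap.const _ x₀)),
      ∀ a : G × Equiv.Perm (Fin n), a • x = x →
        a • x₀ = x₀ ∧ ∀ t p, h (t, a • p) = a • h (t, p) := by
  obtain ⟨x₀, h, H⟩ := Realization.exists_equivariant_contraction x
  exact ⟨x₀, h, fun a ha => H (S.chaotic.act a) ha⟩

theorem nonempty_fixedPoints_chaotic_iff (Λ : Subgroup (G × Equiv.Perm (Fin n))) :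
    (MulAction.fixedPoints Λ (S.chaotic.space n)).Nonempty ↔ ∃ x : S.obj n, ∀ a ∈ Λ, a • x = x := by
  constructor
  · rintro ⟨p, hp⟩
    obtain ⟨x, hx⟩ := S.exists_fixed_of_chaotic_fixed p
    exact ⟨x, fun a ha => hx a (hp ⟨a, ha⟩)⟩
  · rintro ⟨x, hx⟩
    obtain ⟨x₀, _, h⟩ := S.exists_chaotic_contraction x
    exact ⟨x₀, fun a => (h a (hx a a.2)).1⟩

/-- The classifying space of the chaotification of `S` in degree `n` is a universal space for the
family of the subgroups of `G × Σₙ` that fix an element of `S.obj n`. -/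
theorem isUniversalSpace_chaotic :
    IsUniversalSpace {Λ : Subgroup (G × Equiv.Perm (Fin n)) | ∃ x : S.obj n, ∀ a ∈ Λ, a • x = x}
      (S.chaotic.space n) := by
  refine fun Λ => ⟨?_, fun hΛ => ?_⟩
  · rintro ⟨x, hx⟩
    obtain ⟨x₀, h, H⟩ := S.exists_chaotic_contraction x
    have hmem : ∀ (t : unitInterval) (p : MulAction.fixedPoints Λ (S.chaotic.space n)),
        h (t, p) ∈ MulAction.fixedPoints Λ (S.chaotic.space n) := fun t p a =>
      ((H a (hx a a.2)).2 t p).symm.trans (congrArg (fun q => h (t, q)) (p.2 a))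
    rw [contractible_iff_id_nullhomotopic]
    refine ⟨⟨x₀, fun a => (H a (hx a a.2)).1⟩, ⟨⟨⟨fun q => ⟨h (q.1, q.2), hmem q.1 q.2⟩, ?_⟩,
      fun p => ?_, fun p => ?_⟩⟩⟩
    · exact Continuous.subtype_mk (h.continuous.comp (by fun_prop)) _
    · exact Subtype.ext (h.apply_zero p.1)
    · exact Subtype.ext (h.apply_one p.1)
  · rw [← Set.not_nonempty_iff_eq_empty, nonempty_fixedPoints_chaotic_iff]
    exact hΛ

theorem isSubgroupFamily_fixing :
    IsSubgroupFamily
      {Λ : Subgroup (G × Equiv.Perm (Fin n)) | ∃ x : S.obj n, ∀ a ∈ Λ, a • x = x} := by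
  refine ⟨?_, ?_⟩
  · rintro Λ ⟨x, hx⟩ Λ' hle
    exact ⟨x, fun a ha => hx a (hle ha)⟩
  · rintro Λ ⟨x, hx⟩ g
    refine ⟨g • x, ?_⟩
    rintro _ ⟨a, ha, rfl⟩
    change (g * a * g⁻¹) • g • x = g • x
    rw [mul_smul, inv_smul_smul, mul_smul, hx a ha]

end SymSeq

/-- The chaotification of an operad `P` is `N∞` as soon as the symmetric groups act freely and every
`P.obj n` contains an element that is fixed by `G`. -/
theorem GSetOperad.chaotic_isNInfty {G : Type u} [Group G] (P : GSetOperad.{u, w} G)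
    (hfree : ∀ (n : ℕ) (σ : Equiv.Perm (Fin n)) (x : P.obj n), ((1 : G), σ) • x = x → σ = 1)
    (hfix : ∀ n, ∃ x : P.obj n, ∀ g : G, (g, (1 : Equiv.Perm (Fin n))) • x = x) :
    P.chaotic.IsNInfty where
  contractible := by
    obtain ⟨x, hx⟩ := hfix 0
    obtain ⟨x₀, h, H⟩ := P.toSymSeq.exists_chaotic_contraction x
    have hx' : ∀ a : G × Equiv.Perm (Fin 0), a • x = x := by
      rintro ⟨g, σ⟩
      obtain rfl : σ = 1 := Subsingleton.elim _ _
      exact hx g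
    exact ⟨x₀, fun a => (H a (hx' a)).1, h, fun a => (H a (hx' a)).2⟩
  free n σ p hp := by
    obtain ⟨x, hx⟩ := P.toSymSeq.exists_fixed_of_chaotic_fixed p
    exact hfree n σ x (hx _ hp)
  universal n := by
    refine ⟨_, P.toSymSeq.isSubgroupFamily_fixing, fun H => ?_, P.toSymSeq.isUniversalSpace_chaotic⟩
    obtain ⟨x, hx⟩ := hfix n
    refine ⟨x, ?_⟩
    rintro ⟨g, σ⟩ ⟨_, hσ⟩
    obtain rfl : σ = 1 := hσ
    exact hx g

/-! ### Free actions on trees -/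

namespace OpTree

variable {G : Type u} [Group G] {S : SymSeq.{u, w} G} {A B : Type}

theorem Iso.node_congr {n : ℕ} (s : S.obj n) {t t' : Fin n → OpTree S A}
    (h : ∀ i, Iso (t i) (t' i)) : Iso (OpTree.node n s t) (OpTree.node n s t') := by
  have h := Iso.node n 1 s t t' h
  have e : ((1 : G), (1 : Equiv.Perm (Fin n))) • s = s := one_smul (G × Equiv.Perm (Fin n)) s
  rwa [e] at h

theorem Iso.exists_perm {n : ℕ} {s s' : S.obj n} {t t' : Fin n → OpTree S A}
    (h : Iso (OpTree.node n s t) (OpTree.node n s' t')) :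
    ∃ σ : Equiv.Perm (Fin n), s = ((1 : G), σ) • s' ∧ ∀ i, Iso (t (σ i)) (t' i) := by
  cases h with
  | node n σ s t t' h => exact ⟨σ, rfl, h⟩

theorem Iso.leaves_eq {t t' : OpTree S A} (h : Iso t t') : t.leaves = t'.leaves := by
  induction h with
  | leaf a => rfl
  | node n σ s t t' _ ih =>
    simp only [leaves, ← ih]
    exact (Equiv.sum_comp σ fun i => (t i).leaves).symm

/-- If the symmetric groups act freely on the labels of the vertices, then a tree has no nontrivial
automorphisms, so that isomorphic relabellings of it agree on its leaves. -/
theorem eqOn_leaves_of_iso_map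
    (hS : ∀ (n : ℕ) (σ : Equiv.Perm (Fin n)) (s : S.obj n), ((1 : G), σ) • s = s → σ = 1)
    (f f' : A → B) : ∀ t : OpTree S A, Iso (t.map f) (t.map f') → ∀ a ∈ t.leaves, f a = f' a
  | leaf a, h, b, hb => by
    obtain rfl : b = a := Multiset.mem_singleton.1 hb
    simp only [map] at h
    generalize hx : (leaf (f b) : OpTree S B) = x at h
    generalize hy : (leaf (f' b) : OpTree S B) = y at h
    cases h with
    | leaf c => exact (OpTree.leaf.inj hx).trans (OpTree.leaf.inj hy).symm
    | node => cases hx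
  | node n s t, h, b, hb => by
    obtain ⟨σ, hσ, h⟩ := Iso.exists_perm h
    obtain rfl := hS n σ s hσ.symm
    obtain ⟨i, _, hi⟩ := Multiset.mem_sum.1 hb
    exact eqOn_leaves_of_iso_map hS f f' (t i) (h i) b hi

end OpTree

theorem FreeOp.perm_eq_one {G : Type u} [Group G] {S : SymSeq.{u, w} G}
    (hS : ∀ (n : ℕ) (σ : Equiv.Perm (Fin n)) (s : S.obj n), ((1 : G), σ) • s = s → σ = 1)
    {n : ℕ} (σ : Equiv.Perm (Fin n)) (x : FreeOp S n) (h : ((1 : G), σ) • x = x) : σ = 1 := by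
  obtain ⟨t, rfl⟩ := FreeOp.exists_rep x
  have h : OpTree.Iso ((t.1.gact 1).map σ) t.1 := Quotient.exact (s := NTree.setoid S n) h
  rw [OpTree.gact_one] at h
  nth_rw 2 [← OpTree.map_id t.1] at h
  refine Equiv.ext fun a => OpTree.eqOn_leaves_of_iso_map hS σ id t.1 h a ?_
  rw [t.2]
  exact Finset.mem_univ a

/-! ### The generating operations -/

section normSeq

variable {G : Type u} [Group G] {N : Exponents G}

/-- The generating operation `b • c`. -/
def normOp (c : NormGen N) (b : G × Equiv.Perm (Fin c.arity)) : (normSeq N).obj c.arity :=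
  NormSeqObj.mk c (QuotientGroup.mk b)

theorem exists_eq_normOp {c : NormGen N} (x : (G × Equiv.Perm (Fin c.arity)) ⧸ c.stab) :
    ∃ b, normOp c b = NormSeqObj.mk c x := by
  obtain ⟨b, rfl⟩ := QuotientGroup.mk_surjective x
  exact ⟨b, rfl⟩

theorem smul_normOp_eq_iff (c : NormGen N) (a b : G × Equiv.Perm (Fin c.arity)) :
    a • normOp c b = normOp c b ↔ b⁻¹ * a * b ∈ c.stab := by
  have h : a • normOp c b = normOp c (a * b) := rfl
  have h' : ∀ x y : (G × Equiv.Perm (Fin c.arity)) ⧸ c.stab,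
      NormSeqObj.mk c x = NormSeqObj.mk c y ↔ x = y := by
    intro x y
    refine ⟨fun h => ?_, congrArg _⟩
    cases h
    rfl
  rw [h]
  refine (h' _ _).trans ?_
  rw [eq_comm, QuotientGroup.eq, mul_assoc]

theorem smul_normOp_one_eq_iff (c : NormGen N) (a : G × Equiv.Perm (Fin c.arity)) :
    a • normOp c 1 = normOp c 1 ↔ a ∈ c.stab := by
  rw [smul_normOp_eq_iff, inv_one, one_mul, mul_one]

/-- The stabilizer of a generating operation is the graph of an action. -/
theorem NormGen.exists_stab_eq (c : NormGen N) :
    ∃ (H : Subgroup G) (T : FinAct H) (e : Fin c.arity ≃ T.carrier), c.stab = T.graph e ∧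
      ((∀ (h : H) (t : T.carrier), h • t = t) ∨ T ∈ N.underlying H) := by
  have key : ∀ n : ℕ, ∃ (T : FinAct (⊤ : Subgroup G)) (e : Fin n ≃ T.carrier),
      graphSubgroup (⊤ : Subgroup G) (1 : (⊤ : Subgroup G) →* Equiv.Perm (Fin n)) = T.graph e ∧
      ∀ (h : (⊤ : Subgroup G)) (t : T.carrier), h • t = t := by
    intro n
    let _ : MulAction (⊤ : Subgroup G) (ULift.{u} (Fin n)) :=
      { smul := fun _ x => x
        one_smul := fun _ => rfl
        mul_smul := fun _ _ _ => rfl }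
    exact ⟨⟨ULift.{u} (Fin n)⟩, Equiv.ulift.symm, rfl, fun _ _ => rfl⟩
  cases c with
  | unit =>
    obtain ⟨T, e, h, h'⟩ := key 0
    exact ⟨⊤, T, e, h, Or.inl h'⟩
  | tensor =>
    obtain ⟨T, e, h, h'⟩ := key 2
    exact ⟨⊤, T, e, h, Or.inl h'⟩
  | norm H T hT => exact ⟨H, T.toFinAct, T.ordering, rfl, Or.inr ⟨T, hT, rfl⟩⟩

theorem FinAct.mem_graph {H : Subgroup G} {T : FinAct H} {n : ℕ} {e : Fin n ≃ T.carrier}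
    {a : G × Equiv.Perm (Fin n)} :
    a ∈ T.graph e ↔ ∃ h : H, (h : G) = a.1 ∧ ∀ i, e.symm (h • e i) = a.2 i := by
  constructor
  · rintro ⟨h, rfl⟩
    exact ⟨h, rfl, fun i => rfl⟩
  · rintro ⟨h, h1, h2⟩
    exact ⟨h, Prod.ext h1 (Equiv.ext h2)⟩

/-- The stabilizers are conjugates of graphs, which meet `1 × Σₙ` trivially. -/
theorem normSeq_perm_eq_one (n : ℕ) (σ : Equiv.Perm (Fin n)) (s : (normSeq N).obj n)
    (h : ((1 : G), σ) • s = s) : σ = 1 := by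
  obtain ⟨c, x⟩ := s
  obtain ⟨b, hb⟩ := exists_eq_normOp x
  rw [← hb, smul_normOp_eq_iff] at h
  obtain ⟨H, T, e, hc, _⟩ := c.exists_stab_eq
  rw [hc, FinAct.mem_graph] at h
  obtain ⟨h, h1, h2⟩ := h
  obtain rfl : h = 1 := Subtype.ext (h1.trans (by simp))
  have h3 : (b.2⁻¹ * σ * b.2 : Equiv.Perm (Fin c.arity)) = 1 :=
    Equiv.ext fun i => (h2 i).symm.trans (by simp)
  rw [mul_assoc, inv_mul_eq_one] at h3
  exact (mul_eq_right.1 h3.symm)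

/-- The operation `⊗`. -/
def tensorGen (N : Exponents G) : (normSeq N).obj 2 :=
  normOp .tensor 1

/-- The operation `e`. -/
def unitGen (N : Exponents G) : (normSeq N).obj 0 :=
  normOp .unit 1

theorem smul_tensorGen (g : G) : (g, (1 : Equiv.Perm (Fin 2))) • tensorGen N = tensorGen N :=
  (smul_normOp_one_eq_iff (N := N) .tensor (g, 1)).2 ⟨⟨g, trivial⟩, rfl⟩

theorem smul_unitGen (g : G) : (g, (1 : Equiv.Perm (Fin 0))) • unitGen N = unitGen N :=
  (smul_normOp_one_eq_iff (N := N) .unit (g, 1)).2 ⟨⟨g, trivial⟩, rfl⟩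

namespace OpTree

variable {A B : Type}

/-- The tree `t ⊗ u`. -/
def tensor (t u : OpTree (normSeq N) A) : OpTree (normSeq N) A := node 2 (tensorGen N) ![t, u]

/-- The tree `e`. -/
def unit (N : Exponents G) (A : Type) : OpTree (normSeq N) A := node 0 (unitGen N) Fin.elim0

theorem gact_unit (g : G) : (unit N A).gact g = unit N A := by
  simp only [unit, gact, smul_unitGen]
  exact congrArg _ (Subsingleton.elim _ _)

theorem map_unit (f : A → B) : (unit N A).map f = unit N B :=
  congrArg (node 0 (unitGen N)) (Subsingleton.elim _ _)

theorem gact_tensor (g : G) (t u : OpTree (normSeq N) A) :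
    (tensor t u).gact g = tensor (t.gact g) (u.gact g) := by
  simp only [tensor, gact, smul_tensorGen]
  congr 1
  funext i
  fin_cases i <;> rfl

theorem map_tensor (f : A → B) (t u : OpTree (normSeq N) A) :
    (tensor t u).map f = tensor (t.map f) (u.map f) := by
  simp only [tensor, map]
  congr 1
  funext i
  fin_cases i <;> rfl

theorem leaves_tensor (t u : OpTree (normSeq N) A) :
    (tensor t u).leaves = t.leaves + u.leaves := by
  simp [tensor, leaves]

theorem Iso.tensor {t t' u u' : OpTree (normSeq N) A} (h : Iso t t') (h' : Iso u u') :
    Iso (OpTree.tensor t u) (OpTree.tensor t' u') := by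
  refine Iso.node_congr _ fun i => ?_
  fin_cases i
  · exact h
  · exact h'

/-- The `n`-fold product `x₁ ⊗ (x₂ ⊗ ⋯ (xₙ ⊗ e))`. -/
def iteratedTensor (N : Exponents G) : ∀ n : ℕ, OpTree (normSeq N) (Fin n)
  | 0 => unit N (Fin 0)
  | n + 1 => tensor (leaf 0) ((iteratedTensor N n).map Fin.succ)

theorem gact_iteratedTensor (g : G) : ∀ n, (iteratedTensor N n).gact g = iteratedTensor N n
  | 0 => gact_unit g
  | n + 1 => by
    simp only [iteratedTensor, gact_tensor, gact_map, gact_iteratedTensor g n, gact]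

theorem leaves_iteratedTensor : ∀ n, (iteratedTensor N n).leaves = Finset.univ.val
  | 0 => rfl
  | n + 1 => by
    simp only [iteratedTensor, leaves_tensor, leaves_map, leaves_iteratedTensor n, leaves]
    rw [Fin.univ_succ]
    simp

end OpTree

end normSeq

theorem normedSMOperad_isNInfty {G : Type u} [Group G] (N : Exponents G) :
    (normedSMOperad N).IsNInfty := by
  refine (freeOperad (normSeq N)).chaotic_isNInfty
    (fun n σ x h => FreeOp.perm_eq_one normSeq_perm_eq_one σ x h) fun n =>
    ⟨FreeOp.mk ⟨OpTree.iteratedTensor N n, OpTree.leaves_iteratedTensor n⟩, fun g => ?_⟩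
  refine FreeOp.sound_eq ?_
  exact (OpTree.map_id _).trans (OpTree.gact_iteratedTensor g n)

/-! ### Admissible sets and trees -/

section trees

variable {G : Type u} [Group G] {S : SymSeq.{u, w} G}

/-- The tree `t`, with leaves numbered by `e : A ≃ T`, exhibits the `H`-set `T` as its set of
leaves: every element of `T` labels exactly one leaf, and for `h ∈ H` the tree `h • t` is isomorphic
to `t` by an isomorphism that acts on the leaves through the action on `T`. -/
structure IsTreeFor {H : Subgroup G} (T : FinAct H) {A : Type} (e : A ≃ T.carrier)
    (t : OpTree S A) : Prop where
  nodup : t.leaves.Nodup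
  mem : ∀ a, a ∈ t.leaves
  iso : ∀ h : H, OpTree.Iso ((t.gact (h : G)).map fun a => e.symm (h • e a)) t

namespace IsTreeFor

variable {H : Subgroup G} {T : FinAct H} {A : Type} {e : A ≃ T.carrier} {t : OpTree S A}

theorem map (ht : IsTreeFor T e t) {B : Type} (ε : A ≃ B) :
    IsTreeFor T (ε.symm.trans e) (t.map ε) where
  nodup := by
    rw [OpTree.leaves_map]
    exact ht.nodup.map ε.injective
  mem b := by
    rw [OpTree.leaves_map]
    exact Multiset.mem_map.2 ⟨ε.symm b, ht.mem _, ε.apply_symm_apply b⟩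
  iso h := by
    have := (ht.iso h).map ε
    simp only [OpTree.gact_map, OpTree.map_map] at this ⊢
    convert this using 2
    funext a
    simp

/-- Grafting an equivariant family of trees onto the leaves of a tree. -/
theorem bind (ht : IsTreeFor T e t) {U : FinAct H} {B : Type} {e' : B ≃ U.carrier}
    {π : U.carrier → T.carrier} {f : A → OpTree S B}
    (hf : ∀ a, (f a).leaves.Nodup) (hmem : ∀ a b, b ∈ (f a).leaves ↔ π (e' b) = e a)
    (hiso : ∀ (h : H) a, OpTree.Iso (((f a).gact (h : G)).map fun b => e'.symm (h • e' b))
      (f (e.symm (h • e a)))) :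
    IsTreeFor U e' (t.bind f) where
  nodup := by
    rw [OpTree.leaves_bind, Multiset.nodup_bind]
    refine ⟨fun a _ => hf a, ht.nodup.pairwise fun a _ a' _ ha => ?_⟩
    rw [Function.onFun, Multiset.disjoint_left]
    intro b hb hb'
    exact ha (e.injective (((hmem a b).1 hb).symm.trans ((hmem a' b).1 hb')))
  mem b := by
    rw [OpTree.leaves_bind, Multiset.mem_bind]
    exact ⟨e.symm (π (e' b)), ht.mem _, (hmem _ _).2 (e.apply_symm_apply _).symm⟩
  iso h := by
    rw [OpTree.gact_bind, OpTree.map_bind]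
    refine (OpTree.Iso.bind_right (hiso h) _).trans ?_
    rw [← OpTree.bind_map (fun a => e.symm (h • e a)) f]
    exact OpTree.Iso.bind (fun a => .refl _) (ht.iso h)

end IsTreeFor

theorem freeOperad_mem_admissible_iff {H : Subgroup G} {T : FinAct H} :
    T ∈ (freeOperad S).chaotic.admissible H ↔
      ∃ (A : Type) (e : A ≃ T.carrier) (t : OpTree S A), IsTreeFor T e t := by
  constructor
  · rintro ⟨n, e, h⟩
    obtain ⟨x, hx⟩ := ((freeOperad S).toSymSeq.nonempty_fixedPoints_chaotic_iff _).1 h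
    obtain ⟨t, rfl⟩ := FreeOp.exists_rep x
    refine ⟨Fin n, e, t.1, ?_, fun a => ?_, fun h => ?_⟩
    · rw [t.2]
      exact Finset.univ.nodup
    · rw [t.2]
      exact Finset.mem_univ a
    · exact Quotient.exact (s := NTree.setoid S n) (hx ((h : G), T.permRep e h) ⟨h, rfl⟩)
  · rintro ⟨A, e, t, ht⟩
    have : Finite A := Finite.of_equiv _ e.symm
    let ε := Finite.equivFin A
    refine ⟨_, ε.symm.trans e,
      ((freeOperad S).toSymSeq.nonempty_fixedPoints_chaotic_iff _).2 ?_⟩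
    have ht' := ht.map ε
    have hl : (t.map ε).leaves = Finset.univ.val :=
      (Multiset.Nodup.ext ht'.nodup Finset.univ.nodup).2 fun a => by
        simpa using ht'.mem a
    refine ⟨FreeOp.mk ⟨t.map ε, hl⟩, ?_⟩
    rintro _ ⟨h, rfl⟩
    exact FreeOp.sound (ht'.iso h)

theorem IsTreeFor.mem_admissible {H : Subgroup G} {T : FinAct H} {A : Type} {e : A ≃ T.carrier}
    {t : OpTree S A} (ht : IsTreeFor T e t) : T ∈ (freeOperad S).chaotic.admissible H :=
  freeOperad_mem_admissible_iff.2 ⟨A, e, t, ht⟩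

end trees

/-! ### Closure properties of the admissible sets -/

section closure

variable {G : Type u} [Group G] {S : SymSeq.{u, w} G}

theorem iso_mem_admissible {H : Subgroup G} {T U : FinAct H} (f : T.carrier ≃ U.carrier)
    (hf : FinAct.IsEquivariant f) (hT : T ∈ (freeOperad S).chaotic.admissible H) :
    U ∈ (freeOperad S).chaotic.admissible H := by
  obtain ⟨A, e, t, ht⟩ := freeOperad_mem_admissible_iff.1 hT
  refine IsTreeFor.mem_admissible (e := e.trans f) (t := t) ⟨ht.nodup, ht.mem, fun h => ?_⟩
  convert ht.iso h using 3 with a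
  simp [← hf h]

theorem restrict_mem_admissible {K H : Subgroup G} (hKH : K ≤ H) {T : FinAct H}
    (hT : T ∈ (freeOperad S).chaotic.admissible H) :
    T.comap (Subgroup.inclusion hKH) ∈ (freeOperad S).chaotic.admissible K := by
  obtain ⟨A, e, t, ht⟩ := freeOperad_mem_admissible_iff.1 hT
  exact IsTreeFor.mem_admissible (T := T.comap (Subgroup.inclusion hKH)) (e := e) (t := t)
    ⟨ht.nodup, ht.mem, fun k => ht.iso (Subgroup.inclusion hKH k)⟩

/-- The element `g h g⁻¹` of `g H g⁻¹`. -/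
def conjElement {H : Subgroup G} (g : G) (h : H) : H.map (MulAut.conj g).toMonoidHom :=
  (MulAut.conj g).subgroupMap H h

theorem exists_eq_conjElement {H : Subgroup G} (g : G) (h' : H.map (MulAut.conj g).toMonoidHom) :
    ∃ h, conjElement g h = h' :=
  ((MulAut.conj g).subgroupMap H).surjective h'

theorem coe_conjElement {H : Subgroup G} (g : G) (h : H) :
    (conjElement g h : G) = g * h * g⁻¹ := rfl

theorem FinAct.conjElement_smul {H : Subgroup G} (g : G) (T : FinAct H) (h : H)
    (x : (T.conj g).carrier) : conjElement g h • x = (h • (show T.carrier from x) : T.carrier) :=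
  congrArg (· • (show T.carrier from x)) (((MulAut.conj g).subgroupMap H).symm_apply_apply h)

theorem conj_mem_admissible {H : Subgroup G} (g : G) {T : FinAct H}
    (hT : T ∈ (freeOperad S).chaotic.admissible H) :
    T.conj g ∈ (freeOperad S).chaotic.admissible (H.map (MulAut.conj g).toMonoidHom) := by
  obtain ⟨A, e, t, ht⟩ := freeOperad_mem_admissible_iff.1 hT
  refine IsTreeFor.mem_admissible (T := T.conj g) (e := e) (t := t.gact g) ⟨?_, ?_, fun h' => ?_⟩
  · rw [OpTree.leaves_gact]
    exact ht.nodup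
  · rw [OpTree.leaves_gact]
    exact ht.mem
  · obtain ⟨h, rfl⟩ := exists_eq_conjElement g h'
    have h1 := (ht.iso h).gact g
    have h2 : (conjElement g h : G) * g = g * h := by
      rw [coe_conjElement, inv_mul_cancel_right]
    rw [OpTree.gact_map, ← OpTree.gact_mul, ← h2, OpTree.gact_mul] at h1
    convert h1 using 3 with a
    exact congrArg e.symm (T.conjElement_smul g h (e a))

/-- The fibres of `T × U` over `T` are copies of `U`. -/
theorem prod_mem_admissible {H : Subgroup G} {T U : FinAct H}
    (hT : T ∈ (freeOperad S).chaotic.admissible H) (hU : U ∈ (freeOperad S).chaotic.admissible H) :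
    T.prod U ∈ (freeOperad S).chaotic.admissible H := by
  obtain ⟨A, e, t, ht⟩ := freeOperad_mem_admissible_iff.1 hT
  obtain ⟨B, e', t', ht'⟩ := freeOperad_mem_admissible_iff.1 hU
  refine (ht.bind (U := T.prod U) (e' := Equiv.prodCongr e e') (π := Prod.fst)
    (f := fun a => t'.map (Prod.mk a)) (fun a => ?_) (fun a b => ?_) fun h a => ?_).mem_admissible
  · rw [OpTree.leaves_map]
    exact ht'.nodup.map (Prod.mk_right_injective a)
  · rw [OpTree.leaves_map, Multiset.mem_map]
    constructor
    · rintro ⟨b, _, rfl⟩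
      rfl
    · intro h
      exact ⟨b.2, ht'.mem _, Prod.ext (e.injective h).symm rfl⟩
  · have h1 := (ht'.iso h).map (Prod.mk (e.symm (h • e a)))
    simp only [OpTree.gact_map, OpTree.map_map] at h1 ⊢
    exact h1

/-- The induced set `H ×_K T` lies over `H/K`, and its fibre over `hK` is the conjugate of `T` by
`h`. Hence the tree `h • t` is grafted onto the leaf `hK` of a tree for `H/K`; up to isomorphism,
it does not depend on the choice of `h` in its coset. -/
theorem induced_mem_admissible [Finite G] {K H : Subgroup G} (hKH : K ≤ H) {T : FinAct K}
    (hO : FinAct.orbit K H ∈ (freeOperad S).chaotic.admissible H)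
    (hT : T ∈ (freeOperad S).chaotic.admissible K) :
    FinAct.induced hKH T ∈ (freeOperad S).chaotic.admissible H := by
  obtain ⟨A, e, t, ht⟩ := freeOperad_mem_admissible_iff.1 hO
  obtain ⟨B, e', t', ht'⟩ := freeOperad_mem_admissible_iff.1 hT
  have e₂ := (Finite.equivFin (FinAct.induced hKH T).carrier).symm
  let q : A → H ⧸ K.subgroupOf H := e
  let s : A → H := fun a => (q a).out
  have hs : ∀ a, QuotientGroup.mk (s a) = q a := fun a => QuotientGroup.out_eq' _
  -- The class of `(h, x)` in `H ×_K T`.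
  let mk : H → T.carrier → (FinAct.induced hKH T).carrier := fun h x => Quotient.mk _ (h, x)
  have hmk : ∀ h x h' x', mk h x = mk h' x' ↔
      ∃ k : K, h' = h * (Subgroup.inclusion hKH k)⁻¹ ∧ x' = k • x := by
    intro h x h' x'
    refine Quotient.eq.trans (exists_congr fun k => ?_)
    exact Prod.ext_iff
  have hcos : ∀ h h' : H, QuotientGroup.mk (s := K.subgroupOf H) h = QuotientGroup.mk h' ↔
      ∃ k : K, h = h' * Subgroup.inclusion hKH k := by
    intro h h'
    rw [eq_comm, QuotientGroup.eq]
    constructor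
    · intro hk
      exact ⟨⟨_, Subgroup.mem_subgroupOf.1 hk⟩, by ext; simp⟩
    · rintro ⟨k, rfl⟩
      rw [inv_mul_cancel_left]
      exact Subgroup.mem_subgroupOf.2 k.2
  let π : (FinAct.induced hKH T).carrier → (FinAct.orbit K H).carrier :=
    Quotient.lift (fun x => (QuotientGroup.mk x.1 : H ⧸ K.subgroupOf H)) (by
      rintro ⟨h, x⟩ _ ⟨k, rfl⟩
      exact (hcos _ _).2 ⟨k, by simp⟩)
  refine (ht.bind (U := FinAct.induced hKH T) (e' := e₂) (π := π)
    (f := fun a => (t'.gact (s a : G)).map fun b => e₂.symm (mk (s a) (e' b)))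
    (fun a => ?_) (fun a b => ?_) fun h a => ?_).mem_admissible
  · rw [OpTree.leaves_map, OpTree.leaves_gact]
    refine ht'.nodup.map fun b b' hb => ?_
    obtain ⟨k, h1, h2⟩ := (hmk _ _ _ _).1 (e₂.symm.injective hb)
    have hk : k = 1 := by
      have h3 := inv_eq_one.1 (left_eq_mul.1 h1)
      exact Subgroup.inclusion_injective hKH (h3.trans (map_one _).symm)
    rw [hk, one_smul] at h2
    exact (e'.injective h2).symm
  · rw [OpTree.leaves_map, OpTree.leaves_gact, Multiset.mem_map]
    constructor
    · rintro ⟨b, _, rfl⟩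
      rw [Equiv.apply_symm_apply]
      exact hs a
    · intro h
      obtain ⟨⟨h', x⟩, hx⟩ := Quotient.exists_rep (e₂ b)
      rw [← hx] at h
      obtain ⟨k, hk⟩ := (hcos h' (s a)).1 (h.trans (hs a).symm)
      refine ⟨e'.symm (k • x), ht'.mem _, e₂.symm_apply_eq.2 (Eq.trans ?_ hx)⟩
      exact ((hmk _ _ _ _).2 ⟨k, by rw [hk]; simp, by simp⟩).symm
  · obtain ⟨k, hk⟩ := (hcos (h * s a) (s (e.symm (h • e a)))).1 (by
      have h1 : q (e.symm (h • e a)) = h • q a := e.apply_symm_apply (h • e a)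
      rw [hs, h1, ← hs a]
      rfl)
    have h1 := ((ht'.iso k).gact (s (e.symm (h • e a)) : G)).map
      fun b => e₂.symm (mk (s (e.symm (h • e a))) (e' b))
    have hk' : (h : G) * (s a : G) = (s (e.symm (h • e a)) : G) * (k : G) :=
      congrArg Subtype.val hk
    simp only [OpTree.gact_map, OpTree.map_map, ← OpTree.gact_mul, ← hk'] at h1 ⊢
    convert h1 using 2
    funext b
    have h2 : h • mk (s a) (e' b) = mk (h * s a) (e' b) := rfl
    simp only [Function.comp, Equiv.apply_symm_apply, h2, EmbeddingLike.apply_eq_iff_eq]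
    exact (hmk _ _ _ _).2 ⟨k, by rw [hk]; simp, rfl⟩

variable {N : Exponents G}

theorem trivial_mem_admissible {H : Subgroup G} {T : FinAct H}
    (hT : ∀ (h : H) (t : T.carrier), h • t = t) : T ∈ (normedSMOperad N).admissible H := by
  refine IsTreeFor.mem_admissible (S := normSeq N) (T := T) (e := (Finite.equivFin T.carrier).symm)
    (t := OpTree.iteratedTensor N _) ⟨?_, fun a => ?_, fun h => ?_⟩
  · rw [OpTree.leaves_iteratedTensor]
    exact Finset.univ.nodup
  · rw [OpTree.leaves_iteratedTensor]
    exact Finset.mem_univ a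
  · simp only [hT, Equiv.symm_apply_apply, OpTree.gact_iteratedTensor]
    have h1 := OpTree.map_id (OpTree.iteratedTensor N (Nat.card T.carrier))
    exact h1.symm ▸ OpTree.Iso.refl _

/-- The leaves outside of a subobject are removed by plugging in the unit `e`. -/
theorem subobject_mem_admissible {H : Subgroup G} {U T : FinAct H} (i : U.carrier → T.carrier)
    (hi : Function.Injective i) (hequiv : FinAct.IsEquivariant i)
    (hT : T ∈ (normedSMOperad N).admissible H) : U ∈ (normedSMOperad N).admissible H := by
  classical
  obtain ⟨A, e, t, ht⟩ := freeOperad_mem_admissible_iff.1 hT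
  have e₂ := (Finite.equivFin U.carrier).symm
  let f : A → OpTree (normSeq N) (Fin (Nat.card U.carrier)) := fun a =>
    if h : ∃ b, i (e₂ b) = e a then .leaf h.choose else .unit N _
  have hf : ∀ a b, i (e₂ b) = e a → f a = .leaf b := by
    intro a b hb
    have h : ∃ b, i (e₂ b) = e a := ⟨b, hb⟩
    simp only [f, dif_pos h]
    exact congrArg _ (e₂.injective (hi (h.choose_spec.trans hb.symm)))
  have hf' : ∀ a, (∀ b, i (e₂ b) ≠ e a) → f a = .unit N _ := fun a ha =>
    dif_neg fun ⟨b, hb⟩ => ha b hb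
  refine (ht.bind (U := U) (e' := e₂) (π := i) (f := f)
    (fun a => ?_) (fun a b => ?_) fun h a => ?_).mem_admissible
  · by_cases ha : ∃ b, i (e₂ b) = e a
    · obtain ⟨b, hb⟩ := ha
      rw [hf a b hb]
      exact Multiset.nodup_singleton b
    · rw [hf' a fun b hb => ha ⟨b, hb⟩]
      exact Multiset.nodup_zero
  · constructor
    · intro h
      by_contra hb
      by_cases ha : ∃ b, i (e₂ b) = e a
      · obtain ⟨b', hb'⟩ := ha
        rw [hf a b' hb', OpTree.leaves, Multiset.mem_singleton] at h
        exact hb (h ▸ hb')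
      · rw [hf' a fun b hb => ha ⟨b, hb⟩] at h
        exact Multiset.notMem_zero _ h
    · intro hb
      rw [hf a b hb]
      exact Multiset.mem_singleton_self b
  · by_cases ha : ∃ b, i (e₂ b) = e a
    · obtain ⟨b, hb⟩ := ha
      rw [hf a b hb, hf _ (e₂.symm (h • e₂ b)) (by simp [hequiv h, hb])]
      exact .refl _
    · rw [hf' a fun b hb => ha ⟨b, hb⟩, hf' _ fun b hb => ha ⟨e₂.symm (h⁻¹ • e₂ b), by
        rw [e.apply_symm_apply] at hb
        rw [Equiv.apply_symm_apply, hequiv, hb, inv_smul_smul]⟩, OpTree.gact_unit, OpTree.map_unit]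
      exact .refl _

theorem sum_mem_admissible {H : Subgroup G} {T U : FinAct H}
    (hT : T ∈ (normedSMOperad N).admissible H) (hU : U ∈ (normedSMOperad N).admissible H) :
    T.sum U ∈ (normedSMOperad N).admissible H := by
  obtain ⟨A, e, t, ht⟩ := freeOperad_mem_admissible_iff.1 hT
  obtain ⟨B, e', t', ht'⟩ := freeOperad_mem_admissible_iff.1 hU
  refine IsTreeFor.mem_admissible (T := T.sum U) (e := Equiv.sumCongr e e')
    (t := (t.map Sum.inl).tensor (t'.map Sum.inr)) ⟨?_, ?_, fun h => ?_⟩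
  · rw [OpTree.leaves_tensor, OpTree.leaves_map, OpTree.leaves_map, Multiset.nodup_add]
    refine ⟨ht.nodup.map Sum.inl_injective, ht'.nodup.map Sum.inr_injective, ?_⟩
    rw [Multiset.disjoint_left]
    intro x hx hx'
    obtain ⟨a, _, rfl⟩ := Multiset.mem_map.1 hx
    obtain ⟨b, _, hb⟩ := Multiset.mem_map.1 hx'
    cases hb
  · rw [OpTree.leaves_tensor, OpTree.leaves_map, OpTree.leaves_map]
    rintro (a | b)
    · exact Multiset.mem_add.2 (Or.inl (Multiset.mem_map_of_mem _ (ht.mem a)))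
    · exact Multiset.mem_add.2 (Or.inr (Multiset.mem_map_of_mem _ (ht'.mem b)))
  · rw [OpTree.gact_tensor, OpTree.map_tensor]
    refine OpTree.Iso.tensor ?_ ?_
    · have h1 := (ht.iso h).map (Sum.inl : A → A ⊕ B)
      rw [OpTree.map_map] at h1
      rw [OpTree.gact_map, OpTree.map_map]
      exact h1
    · have h1 := (ht'.iso h).map (Sum.inr : B → A ⊕ B)
      rw [OpTree.map_map] at h1
      rw [OpTree.gact_map, OpTree.map_map]
      exact h1

/-- The corolla on the generating operation `⨂_T` is fixed by the graph of `T`. -/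
theorem underlying_le_admissible : N.underlying ≤ (normedSMOperad N).admissible := by
  rintro H _ ⟨T, hT, rfl⟩
  refine ⟨T.card, T.ordering,
    ((freeOperad (normSeq N)).toSymSeq.nonempty_fixedPoints_chaotic_iff _).2 ?_⟩
  refine ⟨FreeOp.unit (normOp (.norm H T hT) 1), fun a ha => ?_⟩
  refine (FreeOp.unit_smul (S := normSeq N) a _).symm.trans (congrArg _ ?_)
  exact (smul_normOp_one_eq_iff (.norm H T hT) a).2 ha

theorem isIndexingSystem_admissible [Finite G] :
    IsIndexingSystem (normedSMOperad N).admissible where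
  trivial_mem _ _ := trivial_mem_admissible
  iso_mem _ _ _ := iso_mem_admissible
  restrict_mem _ _ hKH _ := restrict_mem_admissible hKH
  conj_mem _ g _ := conj_mem_admissible g
  subobject_mem _ _ _ := subobject_mem_admissible
  sum_mem _ _ _ := sum_mem_admissible
  prod_mem _ _ _ := prod_mem_admissible
  induced_mem _ _ hKH _ := induced_mem_admissible hKH

end closure

/-! ### Indexing systems are determined by their orbits -/

section transfer

variable {G : Type u} [Group G]

/-- The stabilizer of a point of an `H`-set, as a subgroup of `G`. -/
def FinAct.stab {H : Subgroup G} (T : FinAct H) (t : T.carrier) : Subgroup G :=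
  (MulAction.stabilizer H t).map H.subtype

theorem FinAct.stab_le {H : Subgroup G} (T : FinAct H) (t : T.carrier) : T.stab t ≤ H := by
  rintro _ ⟨h, _, rfl⟩
  exact h.2

theorem FinAct.orbit_mk_eq_iff {K H : Subgroup G} {a b : H} :
    (QuotientGroup.mk a : H ⧸ K.subgroupOf H) = QuotientGroup.mk b ↔ (a : G)⁻¹ * b ∈ K := by
  rw [QuotientGroup.eq, Subgroup.mem_subgroupOf]
  rfl

variable [Finite G]

/-- The relation `K → H` of the transfer system of a graded class of finite actions: `H/K` is in the
class. -/
def IsTransfer (F : GradedClass G) (K H : Subgroup G) : Prop :=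
  K ≤ H ∧ FinAct.orbit K H ∈ F H

/-- The base point of `H/K`. -/
def FinAct.orbitPoint (K H : Subgroup G) : (FinAct.orbit K H).carrier :=
  (QuotientGroup.mk 1 : H ⧸ K.subgroupOf H)

theorem FinAct.smul_orbitPoint_eq_iff {K H : Subgroup G} (h : H) :
    h • FinAct.orbitPoint K H = FinAct.orbitPoint K H ↔ (h : G) ∈ K := by
  have h1 : h • FinAct.orbitPoint K H = (QuotientGroup.mk (h * 1) : H ⧸ K.subgroupOf H) := rfl
  rw [h1]
  refine eq_comm.trans ((FinAct.orbit_mk_eq_iff (a := 1) (b := h * 1)).trans ?_)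
  simp

/-- The inclusion of an orbit. -/
theorem FinAct.exists_orbit_map {H : Subgroup G} (T : FinAct H) (t : T.carrier) :
    ∃ i : (FinAct.orbit (T.stab t) H).carrier → T.carrier, Function.Injective i ∧
      FinAct.IsEquivariant i ∧ i (FinAct.orbitPoint _ H) = t := by
  have key : ∀ L : Subgroup H, L = MulAction.stabilizer H t →
      ∃ i : H ⧸ L → T.carrier, Function.Injective i ∧ (∀ (h : H) x, i (h • x) = h • i x) ∧
        i (QuotientGroup.mk 1) = t := by
    rintro L rfl
    exact ⟨MulAction.ofQuotientStabilizer H t, MulAction.injective_ofQuotientStabilizer H t,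
      MulAction.ofQuotientStabilizer_smul H t, one_smul H t⟩
  exact key _ (Subgroup.comap_map_eq_self_of_injective H.subtype_injective _)

variable {F : GradedClass G}

namespace IsIndexingSystem

theorem isTransfer_stab (hF : IsIndexingSystem F) {H : Subgroup G} {T : FinAct H} (hT : T ∈ F H)
    (t : T.carrier) : IsTransfer F (T.stab t) H := by
  obtain ⟨i, hi, hi', _⟩ := T.exists_orbit_map t
  exact ⟨T.stab_le t, hF.subobject_mem H _ T i hi hi' hT⟩

/-- Finitely many orbits of `T` are simultaneously embedded into a coproduct of orbits. -/
theorem exists_injOn_orbits (hF : IsIndexingSystem F) {H : Subgroup G} {T : FinAct H}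
    (hT : ∀ t, IsTransfer F (T.stab t) H) (s : Finset T.carrier) :
    ∃ X ∈ F H, ∃ f : T.carrier → X.carrier, FinAct.IsEquivariant f ∧
      Set.InjOn f {t | ∃ x ∈ s, t ∈ MulAction.orbit H x} := by
  classical
  induction s using Finset.induction_on with
  | empty =>
    let _ : MulAction H PUnit.{u + 1} :=
      { smul := fun _ x => x
        one_smul := fun _ => rfl
        mul_smul := fun _ _ _ => rfl }
    refine ⟨⟨PUnit.{u + 1}⟩, hF.trivial_mem H _ fun _ _ => rfl, fun _ => PUnit.unit,
      fun _ _ => rfl, ?_⟩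
    rintro t ⟨x, hx, _⟩
    exact absurd hx (Finset.notMem_empty x)
  | insert y s _ ih =>
    obtain ⟨X, hX, f, hf, hinj⟩ := ih
    obtain ⟨i, hi, hi', hy⟩ := T.exists_orbit_map y
    -- The orbit of `y` goes to the new summand, and all other points to the old one.
    let f' : T.carrier → (X.sum (FinAct.orbit (T.stab y) H)).carrier := fun t =>
      if h : ∃ q, i q = t then Sum.inr h.choose else Sum.inl (f t)
    have h1 : ∀ q, f' (i q) = Sum.inr q := by
      intro q
      have h : ∃ q', i q' = i q := ⟨q, rfl⟩
      exact (dif_pos h).trans (congrArg Sum.inr (hi h.choose_spec))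
    have h2 : ∀ t, (∀ q, i q ≠ t) → f' t = Sum.inl (f t) := fun t ht =>
      dif_neg fun ⟨q, hq⟩ => ht q hq
    refine ⟨_, hF.sum_mem H _ _ hX (hT y).2, f', fun h t => ?_, ?_⟩
    · by_cases ht : ∃ q, i q = t
      · obtain ⟨q, rfl⟩ := ht
        rw [← hi', h1, h1]
        rfl
      · rw [h2 t fun q hq => ht ⟨q, hq⟩, h2 (h • t) fun q hq => ht ⟨h⁻¹ • q, by
          rw [hi', hq, inv_smul_smul]⟩, hf]
        rfl
    · have h3 : ∀ t, (∀ q, i q ≠ t) → (∃ x ∈ insert y s, t ∈ MulAction.orbit H x) →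
          ∃ x ∈ s, t ∈ MulAction.orbit H x := by
        rintro t ht ⟨x, hx, h, rfl⟩
        rcases Finset.mem_insert.1 hx with rfl | hx
        · refine absurd ?_ (ht (h • FinAct.orbitPoint _ H))
          rw [hi', hy]
        · exact ⟨x, hx, h, rfl⟩
      intro t ht t' ht' heq
      by_cases hq : ∃ q, i q = t <;> by_cases hq' : ∃ q, i q = t'
      · obtain ⟨q, rfl⟩ := hq
        obtain ⟨q', rfl⟩ := hq'
        rw [h1, h1] at heq
        exact congrArg i (Sum.inr_injective heq)
      · obtain ⟨q, rfl⟩ := hq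
        rw [h1, h2 t' fun q hq => hq' ⟨q, hq⟩] at heq
        cases heq
      · obtain ⟨q', rfl⟩ := hq'
        rw [h1, h2 t fun q h => hq ⟨q, h⟩] at heq
        cases heq
      · rw [h2 t fun q h => hq ⟨q, h⟩, h2 t' fun q hq => hq' ⟨q, hq⟩] at heq
        exact hinj (h3 t (fun q h => hq ⟨q, h⟩) ht) (h3 t' (fun q h => hq' ⟨q, h⟩) ht')
          (Sum.inl_injective heq)

theorem mem_of_isTransfer_stab (hF : IsIndexingSystem F) {H : Subgroup G} {T : FinAct H}
    (hT : ∀ t, IsTransfer F (T.stab t) H) : T ∈ F H := by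
  have := Fintype.ofFinite T.carrier
  obtain ⟨X, hX, f, hf, hinj⟩ := hF.exists_injOn_orbits hT Finset.univ
  refine hF.subobject_mem H T X f (fun t t' h => ?_) hf hX
  exact hinj ⟨t, Finset.mem_univ t, MulAction.mem_orbit_self t⟩
    ⟨t', Finset.mem_univ t', MulAction.mem_orbit_self t'⟩ h

theorem isTransfer_refl (hF : IsIndexingSystem F) (H : Subgroup G) : IsTransfer F H H := by
  refine ⟨le_rfl, hF.trivial_mem H _ fun h t => ?_⟩
  obtain ⟨a, rfl⟩ := QuotientGroup.mk_surjective (s := H.subgroupOf H) t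
  exact FinAct.orbit_mk_eq_iff.2 (H.mul_mem (H.inv_mem (h * a).2) a.2)

/-- The orbit `H/L` embeds into `H ×_K K/L`. -/
theorem isTransfer_trans (hF : IsIndexingSystem F) {L K H : Subgroup G} (h₁ : IsTransfer F L K)
    (h₂ : IsTransfer F K H) : IsTransfer F L H := by
  have h := hF.induced_mem K H h₂.1 _ h₂.2 h₁.2
  have key := hF.isTransfer_stab h (Quotient.mk _ (1, FinAct.orbitPoint L K))
  convert key using 1
  ext g
  constructor
  · intro hg
    refine ⟨⟨g, h₂.1 (h₁.1 hg)⟩, ?_, rfl⟩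
    refine Quotient.sound ⟨⟨g, h₁.1 hg⟩, Prod.ext ?_ ?_⟩
    · ext
      simp
    · exact ((FinAct.smul_orbitPoint_eq_iff _).2 hg).symm
  · rintro ⟨h, hh, rfl⟩
    obtain ⟨k, hk⟩ := Quotient.exact hh
    have hk1 : (1 : H) = h * 1 * (Subgroup.inclusion h₂.1 k)⁻¹ := congrArg Prod.fst hk
    have hk2 : FinAct.orbitPoint L K = k • FinAct.orbitPoint L K := congrArg Prod.snd hk
    rw [mul_one, eq_comm, mul_inv_eq_one] at hk1
    rw [hk1]
    exact (FinAct.smul_orbitPoint_eq_iff k).1 hk2.symm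

theorem isTransfer_inf (hF : IsIndexingSystem F) {K H M : Subgroup G} (h : IsTransfer F K H)
    (hM : M ≤ H) : IsTransfer F (K ⊓ M) M := by
  have key := hF.isTransfer_stab (hF.restrict_mem M H hM _ h.2) (FinAct.orbitPoint K H)
  convert key using 1
  ext g
  constructor
  · rintro ⟨hK, hg⟩
    exact ⟨⟨g, hg⟩, (FinAct.smul_orbitPoint_eq_iff (Subgroup.inclusion hM ⟨g, hg⟩)).2 hK, rfl⟩
  · rintro ⟨m, hm, rfl⟩
    exact ⟨(FinAct.smul_orbitPoint_eq_iff (Subgroup.inclusion hM m)).1 hm, m.2⟩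

end IsIndexingSystem

end transfer

/-! ### Stabilizers of leaves of trees -/

section leafStabilizers

variable {G : Type u} [Group G] {A : Type}

/-- The elements of `G` that occur in `Λ ≤ G × Σ_A` together with a permutation that fixes `a`. -/
def pointStab (Λ : Subgroup (G × Equiv.Perm A)) (a : A) : Subgroup G :=
  (Λ ⊓ (MulAction.stabilizer (Equiv.Perm A) a).comap (MonoidHom.snd _ _)).map (MonoidHom.fst _ _)

theorem mem_pointStab {Λ : Subgroup (G × Equiv.Perm A)} {a : A} {g : G} :
    g ∈ pointStab Λ a ↔ ∃ p, (g, p) ∈ Λ ∧ p a = a := by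
  constructor
  · rintro ⟨⟨_, p⟩, h, rfl⟩
    exact ⟨p, h⟩
  · rintro ⟨p, h⟩
    exact ⟨(g, p), h, rfl⟩

theorem mem_map_fst {Λ : Subgroup (G × Equiv.Perm A)} {g : G} :
    g ∈ Λ.map (MonoidHom.fst _ _) ↔ ∃ p, (g, p) ∈ Λ := by
  constructor
  · rintro ⟨⟨_, p⟩, h, rfl⟩
    exact ⟨p, h⟩
  · rintro ⟨p, h⟩
    exact ⟨(g, p), h, rfl⟩

theorem FinAct.pointStab_graph {H : Subgroup G} (T : FinAct H) {n : ℕ} (e : Fin n ≃ T.carrier)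
    (i : Fin n) : pointStab (T.graph e) i = T.stab (e i) := by
  ext g
  rw [mem_pointStab]
  constructor
  · rintro ⟨p, hp, hi⟩
    obtain ⟨h, rfl, h2⟩ := FinAct.mem_graph.1 hp
    exact ⟨h, (e.symm_apply_eq.1 ((h2 i).trans hi)), rfl⟩
  · rintro ⟨h, hh, rfl⟩
    exact ⟨T.permRep e h, ⟨h, rfl⟩, e.symm_apply_eq.2 hh⟩

theorem FinAct.map_fst_graph {H : Subgroup G} (T : FinAct H) {n : ℕ} (e : Fin n ≃ T.carrier) :
    (T.graph e).map (MonoidHom.fst _ _) = H := by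
  ext g
  rw [mem_map_fst]
  constructor
  · rintro ⟨p, hp⟩
    obtain ⟨h, rfl, _⟩ := FinAct.mem_graph.1 hp
    exact h.2
  · intro hg
    exact ⟨T.permRep e ⟨g, hg⟩, ⟨⟨g, hg⟩, rfl⟩⟩

/-- The stabilizer of the isomorphism class of a tree. -/
def OpTree.isoStab {S : SymSeq.{u, w} G} (t : OpTree S A) : Subgroup (G × Equiv.Perm A) where
  carrier := {x | OpTree.Iso ((t.gact x.1).map x.2) t}
  one_mem' := by
    change OpTree.Iso ((t.gact 1).map id) t
    rw [OpTree.gact_one, OpTree.map_id]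
    exact .refl t
  mul_mem' := by
    rintro ⟨g, p⟩ ⟨h, q⟩ hg hh
    have h1 := ((hh : OpTree.Iso ((t.gact h).map q) t).gact g).map p
    rw [OpTree.gact_map, OpTree.map_map, ← OpTree.gact_mul] at h1
    exact h1.trans hg
  inv_mem' := by
    rintro ⟨g, p⟩ hg
    have h1 := ((hg : OpTree.Iso ((t.gact g).map p) t).gact g⁻¹).map (p⁻¹ : Equiv.Perm A)
    have h2 : (p⁻¹ : Equiv.Perm A) ∘ p = id := funext fun a => p.symm_apply_apply a
    rw [OpTree.gact_map, OpTree.map_map, ← OpTree.gact_mul, inv_mul_cancel, OpTree.gact_one, h2,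
      OpTree.map_id] at h1
    exact h1.symm

/-- The symmetries of a tree permute the branches above its root in accordance with the stabilizer
of the label of the root. -/
theorem OpTree.exists_perm_of_mem_isoStab {S : SymSeq.{u, w} G} {n : ℕ} {s : S.obj n}
    {t : Fin n → OpTree S A} {g : G} {p : Equiv.Perm A}
    (h : (g, p) ∈ (OpTree.node n s t).isoStab) :
    ∃ τ : Equiv.Perm (Fin n), (g, τ) • s = s ∧
      ∀ i, OpTree.Iso (((t i).gact g).map p) (t (τ i)) := by
  obtain ⟨σ, h1, h2⟩ := OpTree.Iso.exists_perm h
  refine ⟨σ⁻¹, ?_, fun i => ?_⟩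
  · have h3 : ((g, σ⁻¹) : G × Equiv.Perm (Fin n)) = (1, σ⁻¹) * (g, 1) := by simp
    have h4 : ((1, σ⁻¹) : G × Equiv.Perm (Fin n)) * (1, σ) = 1 := by
      rw [Prod.mk_mul_mk, inv_mul_cancel, mul_one]
      rfl
    rw [h3, mul_smul, h1, ← mul_smul, h4, one_smul]
  · have h3 := h2 (σ⁻¹ i)
    have h4 : σ (σ⁻¹ i) = i := σ.apply_symm_apply i
    rwa [h4] at h3

theorem Multiset.eq_of_nodup_sum {ι : Type*} [Fintype ι] {m : ι → Multiset A}
    (h : (∑ i, m i).Nodup) {i j : ι} {a : A} (hi : a ∈ m i) (hj : a ∈ m j) : i = j := by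
  classical
  by_contra hij
  have h1 := Multiset.nodup_iff_count_le_one.1 h a
  rw [Multiset.count_sum'] at h1
  have h2 := (Finset.sum_le_sum_of_subset (f := fun k => (m k).count a)
    (Finset.subset_univ {i, j})).trans h1
  rw [Finset.sum_pair hij] at h2
  have h3 := Multiset.one_le_count_iff_mem.2 hi
  have h4 := Multiset.one_le_count_iff_mem.2 hj
  omega

variable {N : Exponents G}

/-- The stabilizer of an operation in the generating sequence is the graph of a conjugate of a
generating action. -/
theorem exists_stabilizer_eq_graph [Finite G] {F : GradedClass G} (hF : IsIndexingSystem F)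
    (hN : N.underlying ≤ F) {n : ℕ} (s : (normSeq N).obj n) :
    ∃ (H : Subgroup G) (T : FinAct H) (e : Fin n ≃ T.carrier), T ∈ F H ∧
      MulAction.stabilizer (G × Equiv.Perm (Fin n)) s = T.graph e := by
  obtain ⟨c, x⟩ := s
  obtain ⟨⟨g, σ⟩, hb⟩ := exists_eq_normOp x
  obtain ⟨H, T, e, hc, hT⟩ := c.exists_stab_eq
  have hTF : T ∈ F H := hT.elim (hF.trivial_mem H T) fun h => hN H h
  refine ⟨_, T.conj g, (σ⁻¹ : Equiv.Perm _).trans e, hF.conj_mem H g T hTF, ?_⟩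
  ext ⟨a, p⟩
  rw [← hb, MulAction.mem_stabilizer_iff, smul_normOp_eq_iff, hc, FinAct.mem_graph,
    FinAct.mem_graph]
  constructor
  · rintro ⟨h, h1, h2⟩
    refine ⟨conjElement g h, ?_, fun i => ?_⟩
    · rw [coe_conjElement, h1]
      simp [mul_assoc]
    · have h3 := congrArg σ (h2 (σ⁻¹ i))
      have h4 : σ ((((g, σ)⁻¹ * (a, p) * (g, σ) : G × Equiv.Perm _)).2 (σ⁻¹ i)) = p i := by
        simp
      exact (congrArg (fun y => σ (e.symm y)) (T.conjElement_smul g h (e (σ⁻¹ i)))).trans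
        (h3.trans h4)
  · rintro ⟨h', h1, h2⟩
    obtain ⟨h, rfl⟩ := exists_eq_conjElement g h'
    refine ⟨h, ?_, fun i => ?_⟩
    · have h3 : a = g * h * g⁻¹ := h1.symm
      simp [h3, mul_assoc]
    · have h3 := congrArg (σ⁻¹ : Equiv.Perm _) (h2 (σ i))
      have h4 : (σ⁻¹ : Equiv.Perm _) (σ (e.symm (h • e (σ⁻¹ (σ i))))) = e.symm (h • e i) := by
        simp
      have h5 : (((g, σ)⁻¹ * (a, p) * (g, σ) : G × Equiv.Perm _)).2 i = σ⁻¹ (p (σ i)) := rfl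
      rw [h5]
      refine h4.symm.trans (Eq.trans ?_ h3)
      exact congrArg (fun y => (σ⁻¹ : Equiv.Perm _) (σ (e.symm y)))
        (T.conjElement_smul g h (e (σ⁻¹ (σ i)))).symm

/-- If `Λ ≤ G × Σ_A` stabilizes the isomorphism class of a tree, then the stabilizer of each leaf
transfers to the projection of `Λ` to `G`, for each indexing system that contains the exponents. By
induction on the tree, the stabilizer of a leaf transfers to that of the branch above the root that
contains it, and the latter transfers to the whole group, because the branches are permuted through
the stabilizer of the label of the root. -/
theorem isTransfer_pointStab [Finite G] {F : GradedClass G} (hF : IsIndexingSystem F)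
    (hN : N.underlying ≤ F) : ∀ t : OpTree (normSeq N) A, t.leaves.Nodup →
      ∀ Λ ≤ t.isoStab, ∀ a ∈ t.leaves,
        IsTransfer F (pointStab Λ a) (Λ.map (MonoidHom.fst _ _))
  | .leaf b, _, Λ, hΛ, a, ha => by
    obtain rfl : a = b := Multiset.mem_singleton.1 ha
    convert hF.isTransfer_refl (Λ.map (MonoidHom.fst _ _)) using 1
    ext g
    rw [mem_pointStab, mem_map_fst]
    refine exists_congr fun p => and_iff_left_of_imp fun h => ?_
    have h1 : OpTree.Iso (OpTree.leaf (p a)) (OpTree.leaf a) := hΛ h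
    exact Multiset.singleton_inj.1 h1.leaves_eq
  | .node n s t, hnd, Λ, hΛ, a, ha => by
    obtain ⟨i, _, hi⟩ := Multiset.mem_sum.1 ha
    have huniq : ∀ j, a ∈ (t j).leaves → j = i := fun j hj => Multiset.eq_of_nodup_sum hnd hj hi
    have hnd' : (t i).leaves.Nodup := Multiset.nodup_of_le
      (Finset.single_le_sum (f := fun i => (t i).leaves) (fun _ _ => Multiset.zero_le _)
        (Finset.mem_univ i)) hnd
    have h1 := isTransfer_pointStab hF hN (t i) hnd' (Λ ⊓ (t i).isoStab) inf_le_right a hi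
    obtain ⟨H, T, e, hT, hs⟩ := exists_stabilizer_eq_graph hF hN s
    have h2 := hF.isTransfer_stab hT (e i)
    rw [← T.pointStab_graph e i, ← hs] at h2
    have hH : H = (MulAction.stabilizer (G × Equiv.Perm (Fin n)) s).map (MonoidHom.fst _ _) := by
      rw [hs, T.map_fst_graph]
    have hle : Λ.map (MonoidHom.fst _ _) ≤ H := by
      intro g hg
      obtain ⟨p, hp⟩ := mem_map_fst.1 hg
      obtain ⟨τ, hτ, _⟩ := OpTree.exists_perm_of_mem_isoStab (hΛ hp)
      rw [hH]
      exact mem_map_fst.2 ⟨τ, hτ⟩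
    have h3 := hF.isTransfer_inf h2 hle
    have e1 : pointStab (Λ ⊓ (t i).isoStab) a = pointStab Λ a := by
      ext g
      rw [mem_pointStab, mem_pointStab]
      refine exists_congr fun p => and_congr_left fun hpa => and_iff_left_of_imp fun hp => ?_
      obtain ⟨τ, _, hτ⟩ := OpTree.exists_perm_of_mem_isoStab (hΛ hp)
      have hmem : a ∈ (t (τ i)).leaves := by
        rw [← (hτ i).leaves_eq, OpTree.leaves_map, OpTree.leaves_gact]
        exact Multiset.mem_map.2 ⟨a, hi, hpa⟩
      have h4 := hτ i
      rw [huniq _ hmem] at h4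
      exact h4
    have e2 : (Λ ⊓ (t i).isoStab).map (MonoidHom.fst _ _) =
        pointStab (MulAction.stabilizer (G × Equiv.Perm (Fin n)) s) i ⊓
          Λ.map (MonoidHom.fst _ _) := by
      ext g
      rw [Subgroup.mem_inf, mem_map_fst, mem_map_fst, mem_pointStab]
      constructor
      · rintro ⟨p, hp, hpi⟩
        obtain ⟨τ, hτ, hτ'⟩ := OpTree.exists_perm_of_mem_isoStab (hΛ hp)
        refine ⟨⟨τ, hτ, huniq _ ?_⟩, p, hp⟩
        rw [← (hτ' i).leaves_eq, (hpi : OpTree.Iso _ _).leaves_eq]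
        exact hi
      · rintro ⟨⟨τ', hτ', hi'⟩, p, hp⟩
        obtain ⟨τ, hτ, hiso⟩ := OpTree.exists_perm_of_mem_isoStab (hΛ hp)
        -- Freeness: an element of `G` is completed to an element of the stabilizer of `s` by at
        -- most one permutation.
        have h4 : τ' * τ⁻¹ = 1 := by
          refine normSeq_perm_eq_one n _ s ?_
          have h5 : ((1 : G), τ' * τ⁻¹) = (g, τ') * (g, τ)⁻¹ := by
            rw [Prod.inv_mk, Prod.mk_mul_mk, mul_inv_cancel]
          rw [h5]
          exact Subgroup.mul_mem (MulAction.stabilizer (G × Equiv.Perm (Fin n)) s) hτ'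
            (Subgroup.inv_mem _ hτ)
        obtain rfl : τ' = τ := mul_inv_eq_one.1 h4
        have h5 := hiso i
        rw [hi'] at h5
        exact ⟨p, hp, h5⟩
    rw [e1, e2] at h1
    exact hF.isTransfer_trans h1 h3

theorem admissible_le [Finite G] {F : GradedClass G} (hF : IsIndexingSystem F)
    (hN : N.underlying ≤ F) : (normedSMOperad N).admissible ≤ F := by
  rintro H T ⟨n, e, h⟩
  obtain ⟨x, hx⟩ :=
    ((freeOperad (normSeq N)).toSymSeq.nonempty_fixedPoints_chaotic_iff _).1 h
  obtain ⟨t, rfl⟩ := FreeOp.exists_rep x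
  refine hF.mem_of_isTransfer_stab fun y => ?_
  obtain ⟨i, rfl⟩ := e.surjective y
  have h1 := isTransfer_pointStab hF hN t.1 (by rw [t.2]; exact Finset.univ.nodup) (T.graph e)
    (fun a ha => Quotient.exact (s := NTree.setoid (normSeq N) n) (hx a ha)) i
    (by rw [t.2]; exact Finset.mem_univ i)
  rwa [T.pointStab_graph e i, T.map_fst_graph e] at h1

end leafStabilizers

theorem mainTheorem2 {G : Type u} [Group G] [Finite G] (N : Exponents G) :
    (normedSMOperad N).IsNInfty ∧
      IsLeast {F : GradedClass G | IsIndexingSystem F ∧ N.underlying ≤ F}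
        (normedSMOperad N).admissible :=
  ⟨normedSMOperad_isNInfty N, ⟨isIndexingSystem_admissible, underlying_le_admissible⟩,
    fun _ hF => admissible_le hF.1 hF.2⟩
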